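/- For a field $K=\mathbb{R}$ or $\mathbb{C}$, let $L_n(K)\subset K^{n^3}$ be the set of structure constants of Lie algebra laws on $K^n$ (skew-symmetry and Jacobi relations), with the usual topology; a law is \emph{rigid} (over $K$) if its orbit under $GL(n,K)$ is open in $L_n(K)$. A Lie algebra is \emph{complete} if its centre is zero and all its derivations are inner. A solvable Lie algebra over $K$ is \emph{completely solvable} if for every element $X$ all the eigenvalues of $\mathrm{ad}\,X$ lie in $K$. The nilradical is the largest nilpotent ideal. A real form of a complex Lie algebra $\mathfrak{g}$ is a real Lie algebra $\mathfrak{g}'$ with $\mathfrak{g}'\otimes_{\mathbb{R}}\mathbb{C}\simeq\mathfrak{g}$. In the tables below, brackets of basis vectors that do not follow by skew-symmetry are zero. Let $\widehat{\mathfrak{g}}_1$ be the real Lie algebra with basis $X_1,\dots,X_8$ and brackets $$[X_1,X_i]=X_{i+1}\ (2\le i\le 4),\quad [X_3,X_2]=X_6,\quad [X_6,X_2]=X_5,$$ $$[X_7,X_i]=X_i\ (i=1,2),\quad [X_7,X_3]=2X_3,\quad [X_7,X_i]=3X_i\ (i=4,6),\quad [X_7,X_5]=4X_5,$$ $$[X_8,X_1]=X_2,\quad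 [X_8,X_2]=-X_1,\quad [X_8,X_4]=-X_6,\quad [X_8,X_6]=X_4,$$ and let $\widehat{\mathfrak{g}}_2$ be the real Lie algebra with basis $X_1,\dots,X_8$ and brackets $$[X_1,X_i]=X_{i+1}\ (i=2,3,5),\quad [X_3,X_2]=-X_5,\quad [X_2,X_4]=X_6,$$ $$[X_7,X_i]=iX_i\ (1\le i\le 6),\quad [X_8,X_i]=X_i\ (i=2,3,4),\quad [X_8,X_i]=2X_i\ (i=5,6).$$ Let $\mathfrak{r}_8^{22}$ be the complex Lie algebra with the same structure constants as $\widehat{\mathfrak{g}}_2$. Let $N_{6,6}$ and $N_{6,7}$ be the real nilpotent Lie algebras with basis $X_1,\dots,X_6$ and brackets $[X_1,X_i]=X_{i+1}$ $(2\le i\le 4)$, $[X_6,X_2]=X_5$, and $[X_3,X_2]=X_6$ for $N_{6,6}$, respectively $[X_3,X_2]=-X_6$ for $N_{6,7}$. Then: 1. $\widehat{\mathfrak{g}}_1$ and $\widehat{\mathfrak{g}}_2$ are solvable, of dimension $8$, rigid over $\mathbb{R}$ and complete, and their second cohomology spaces $H^2(\widehat{\mathfrak{g}}_i,\widehat{\mathfrak{g}}_i)$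 with values in the adjoint module are zero. 2. The nilradical of $\widehat{\mathfrak{g}}_1$ is isomorphic to $N_{6,6}$ and that of $\widehat{\mathfrak{g}}_2$ is isomorphic to $N_{6,7}$. 3. $\mathfrak{r}_8^{22}$ is rigid over $\mathbb{C}$ with $H^2(\mathfrak{r}_8^{22},\mathfrak{r}_8^{22})=0$, and $\widehat{\mathfrak{g}}_1$ and $\widehat{\mathfrak{g}}_2$ are real forms of it. 4. Over $\mathbb{C}$, the operator $\mathrm{ad}(X_8)$ of $\widehat{\mathfrak{g}}_1$ has the eigenvalues $\pm i$; hence $\widehat{\mathfrak{g}}_1$ is not completely solvable. In particular, a rigid solvable real Lie algebra need not be completely solvable. -/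

import Mathlib

open scoped TensorProduct

set_option maxSynthPendingDepth 3

/-! ### The variety of Lie algebra laws on `K^n` -/

/-- `c i j k` is the coefficient of `X_k` in `[X_i, X_j]`. The array `c` is a Lie algebra law when
it is skew-symmetric and satisfies the Jacobi relations. -/
def IsLieLaw {K : Type*} [CommRing K] {n : ℕ} (c : Fin n → Fin n → Fin n → K) : Prop :=
  (∀ i j k, c i j k = -c j i k) ∧
    ∀ i j k l, ∑ m, (c j k m * c i m l + c k i m * c j m l + c i j m * c k m l) = 0

/-- The set `L_n` of Lie algebra laws on `K^n` (in characteristic `0`), cut out in `K^(n^3)` by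
the skew-symmetry and Jacobi relations. As a subtype, it carries the subspace topology. -/
abbrev LieLaw (K : Type*) [Field K] [CharZero K] (n : ℕ) : Type _ :=
  {c : Fin n → Fin n → Fin n → K // IsLieLaw c}

namespace LieLaw

variable {K : Type*} [Field K] [CharZero K] {n : ℕ}

/-- The bracket on `K^n` with the given structure constants. -/
def bracket (μ : LieLaw K n) (x y : Fin n → K) : Fin n → K :=
  fun k => ∑ i, ∑ j, x i * y j * μ.1 i j k

theorem bracket_skew (μ : LieLaw K n) (x y : Fin n → K) : μ.bracket x y = -μ.bracket y x := by
  funext k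
  simp only [bracket, Pi.neg_apply]
  rw [Finset.sum_comm, ← Finset.sum_neg_distrib]
  refine Finset.sum_congr rfl fun j _ => ?_
  rw [← Finset.sum_neg_distrib]
  refine Finset.sum_congr rfl fun i _ => ?_
  rw [μ.2.1 i j k]
  ring

theorem bracket_self (μ : LieLaw K n) (x : Fin n → K) : μ.bracket x x = 0 := by
  funext k
  have h := congrFun (μ.bracket_skew x x) k
  simp only [Pi.neg_apply] at h
  exact self_eq_neg.mp h

theorem bracket_add_left (μ : LieLaw K n) (x y z : Fin n → K) :
    μ.bracket (x + y) z = μ.bracket x z + μ.bracket y z := by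
  funext k
  simp only [bracket, Pi.add_apply, add_mul, Finset.sum_add_distrib]

theorem bracket_add_right (μ : LieLaw K n) (x y z : Fin n → K) :
    μ.bracket x (y + z) = μ.bracket x y + μ.bracket x z := by
  funext k
  simp only [bracket, Pi.add_apply, mul_add, add_mul, Finset.sum_add_distrib]

theorem bracket_smul_right (μ : LieLaw K n) (t : K) (x y : Fin n → K) :
    μ.bracket x (t • y) = t • μ.bracket x y := by
  funext k
  simp only [bracket, Pi.smul_apply, smul_eq_mul, Finset.mul_sum]
  refine Finset.sum_congr rfl fun i _ => Finset.sum_congr rfl fun j _ => ?_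
  ring

theorem bracket_bracket (μ : LieLaw K n) (x y z : Fin n → K) (l : Fin n) :
    μ.bracket x (μ.bracket y z) l =
      ∑ a, ∑ b, ∑ d, x a * y b * z d * ∑ m, μ.1 b d m * μ.1 a m l := by
  simp only [bracket, Finset.mul_sum, Finset.sum_mul]
  refine Finset.sum_congr rfl fun a _ => ?_
  rw [Finset.sum_comm]
  refine Finset.sum_congr rfl fun b _ => ?_
  rw [Finset.sum_comm]
  refine Finset.sum_congr rfl fun d _ => Finset.sum_congr rfl fun m _ => ?_
  ring

theorem bracket_jacobi (μ : LieLaw K n) (x y z : Fin n → K) :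
    μ.bracket x (μ.bracket y z) + μ.bracket y (μ.bracket z x) + μ.bracket z (μ.bracket x y)
      = 0 := by
  funext l
  have h2 : μ.bracket y (μ.bracket z x) l =
      ∑ a, ∑ b, ∑ d, x a * y b * z d * ∑ m, μ.1 d a m * μ.1 b m l := by
    rw [bracket_bracket, Finset.sum_congr rfl fun b _ => Finset.sum_comm, Finset.sum_comm]
    refine Finset.sum_congr rfl fun a _ => Finset.sum_congr rfl fun b _ =>
      Finset.sum_congr rfl fun d _ => ?_
    ring
  have h3 : μ.bracket z (μ.bracket x y) l =
      ∑ a, ∑ b, ∑ d, x a * y b * z d * ∑ m, μ.1 a b m * μ.1 d m l := by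
    rw [bracket_bracket, Finset.sum_comm]
    refine Finset.sum_congr rfl fun a _ => ?_
    rw [Finset.sum_comm]
    refine Finset.sum_congr rfl fun b _ => Finset.sum_congr rfl fun d _ => ?_
    ring
  simp only [Pi.add_apply, Pi.zero_apply]
  rw [bracket_bracket, h2, h3, ← Finset.sum_add_distrib, ← Finset.sum_add_distrib]
  refine Finset.sum_eq_zero fun a _ => ?_
  rw [← Finset.sum_add_distrib, ← Finset.sum_add_distrib]
  refine Finset.sum_eq_zero fun b _ => ?_
  rw [← Finset.sum_add_distrib, ← Finset.sum_add_distrib]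
  refine Finset.sum_eq_zero fun d _ => ?_
  rw [← mul_add, ← mul_add, ← Finset.sum_add_distrib, ← Finset.sum_add_distrib, μ.2.2 a b d l,
    mul_zero]

/-- The Lie algebra `(K^n, μ)`. -/
def Alg (_μ : LieLaw K n) : Type _ := Fin n → K

instance (μ : LieLaw K n) : AddCommGroup μ.Alg := inferInstanceAs (AddCommGroup (Fin n → K))

instance (μ : LieLaw K n) : Module K μ.Alg := inferInstanceAs (Module K (Fin n → K))

instance (μ : LieLaw K n) : Module.Finite K μ.Alg :=
  inferInstanceAs (Module.Finite K (Fin n → K))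

instance (μ : LieLaw K n) : LieRing μ.Alg where
  bracket x y := μ.bracket x y
  add_lie := μ.bracket_add_left
  lie_add := μ.bracket_add_right
  lie_self := μ.bracket_self
  leibniz_lie x y z := by
    have h := μ.bracket_jacobi x y z
    rw [μ.bracket_skew z (μ.bracket x y), μ.bracket_skew z x] at h
    have h' : μ.bracket y (-μ.bracket x z) = -μ.bracket y (μ.bracket x z) := by
      simpa using μ.bracket_smul_right (-1) y (μ.bracket x z)
    rw [h', ← sub_eq_add_neg, ← sub_eq_add_neg, sub_sub, sub_eq_zero] at h
    exact h.trans (add_comm _ _)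

instance (μ : LieLaw K n) : LieAlgebra K μ.Alg where
  lie_smul := μ.bracket_smul_right

/-- The basis vector of `(K^n, μ)` of index `i` (indices start at `0`). -/
def basisVec (μ : LieLaw K n) (i : Fin n) : μ.Alg := (Pi.single i 1 : Fin n → K)

/-- The orbit of a law under `GL(n, K)`, acting by `(g • μ)(u, v) = g (μ (g⁻¹ u, g⁻¹ v))`. -/
def orbit (μ : LieLaw K n) : Set (LieLaw K n) :=
  {ν | ∃ g : (Fin n → K) ≃ₗ[K] (Fin n → K),
    ∀ u v, ν.bracket u v = g (μ.bracket (g.symm u) (g.symm v))}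

/-- A law is rigid if its `GL(n, K)`-orbit is open in the space of all Lie algebra laws on `K^n`. -/
def IsRigid [TopologicalSpace K] (μ : LieLaw K n) : Prop := IsOpen μ.orbit

end LieLaw

/-! ### Notions for Lie algebras -/

section Notions

variable (K : Type*) [Field K] (L : Type*) [LieRing L] [LieAlgebra K L]

/-- The cohomology space `H²(L, L)` with values in the adjoint module: `2`-cocycles modulo
`2`-coboundaries. -/
abbrev H2Adjoint : Type _ :=
  LieModule.Cohomology.twoCocycle K L L ⧸
    (LinearMap.range (LieModule.Cohomology.d₁₂ K L L)).submoduleOf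
      (LieModule.Cohomology.twoCocycle K L L)

/-- `L` is complete: trivial centre and only inner derivations. -/
def IsCompleteLie : Prop :=
  LieAlgebra.center K L = ⊥ ∧ ∀ D : LieDerivation K L L, ∃ x : L, ∀ y : L, D y = ⁅x, y⁆

/-- `L` is completely solvable over `K`: it is solvable and, for every `x`, all the eigenvalues of
`ad x` (in an algebraic closure of `K`) lie in `K`. -/
def IsCompletelySolvable [Module.Finite K L] : Prop :=
  LieAlgebra.IsSolvable L ∧ ∀ x : L, (LieAlgebra.ad K L x).charpoly.Splits

/-- `I` is the nilradical of `L`: the largest ideal that is nilpotent as a Lie algebra. -/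
def IsNilradical {K L} [Field K] [LieRing L] [LieAlgebra K L] (I : LieIdeal K L) : Prop :=
  IsGreatest {J : LieIdeal K L | LieRing.IsNilpotent J} I

/-- The real Lie algebra `L` is a real form of the complex Lie algebra `M`. -/
def IsRealForm (L M : Type*) [LieRing L] [LieAlgebra ℝ L] [LieRing M] [LieAlgebra ℂ M] : Prop :=
  Nonempty ((ℂ ⊗[ℝ] L) ≃ₗ⁅ℂ⁆ M)

end Notions

/-! ### The explicit Lie algebras

A bracket table `t` records `[X_i, X_j] = ∑ k, t i j k • X_k` for some pairs `(i, j)`, with indices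
starting at `1` and at most one of `(i, j)`, `(j, i)` listed; the brackets `[X_j, X_i]` follow by
skew-symmetry and all the others are zero. -/

/-- The structure constants given by a bracket table. -/
def structConst (n : ℕ) (t : ℕ → ℕ → ℕ → ℤ) (i j k : Fin n) : ℤ :=
  t (i + 1) (j + 1) (k + 1) - t (j + 1) (i + 1) (k + 1)

/-- The law over `K` with the integral structure constants given by a bracket table. -/
def lawOfTable (K : Type*) [Field K] [CharZero K] {n : ℕ} (t : ℕ → ℕ → ℕ → ℤ)
    (h : IsLieLaw (structConst n t)) : LieLaw K n :=
  ⟨fun i j k => (structConst n t i j k : K),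
    fun i j k => by simpa using congrArg (Int.cast (R := K)) (h.1 i j k),
    fun i j k l => by simpa using congrArg (Int.cast (R := K)) (h.2 i j k l)⟩

/-- Brackets of `N_{6,6}`. -/
def tableN66 : ℕ → ℕ → ℕ → ℤ
  | 1, 2, 3 => 1
  | 1, 3, 4 => 1
  | 1, 4, 5 => 1
  | 3, 2, 6 => 1
  | 6, 2, 5 => 1
  | _, _, _ => 0

/-- Brackets of `N_{6,7}`. -/
def tableN67 : ℕ → ℕ → ℕ → ℤ
  | 1, 2, 3 => 1
  | 1, 3, 4 => 1
  | 1, 4, 5 => 1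
  | 3, 2, 6 => -1
  | 6, 2, 5 => 1
  | _, _, _ => 0

/-- Brackets of the first eight-dimensional algebra. -/
def tableG1 : ℕ → ℕ → ℕ → ℤ
  | 1, 2, 3 => 1
  | 1, 3, 4 => 1
  | 1, 4, 5 => 1
  | 3, 2, 6 => 1
  | 6, 2, 5 => 1
  | 7, 1, 1 => 1
  | 7, 2, 2 => 1
  | 7, 3, 3 => 2
  | 7, 4, 4 => 3
  | 7, 5, 5 => 4
  | 7, 6, 6 => 3
  | 8, 1, 2 => 1
  | 8, 2, 1 => -1
  | 8, 4, 6 => -1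
  | 8, 6, 4 => 1
  | _, _, _ => 0

/-- Brackets of the second eight-dimensional algebra. -/
def tableG2 : ℕ → ℕ → ℕ → ℤ
  | 1, 2, 3 => 1
  | 1, 3, 4 => 1
  | 1, 5, 6 => 1
  | 3, 2, 5 => -1
  | 2, 4, 6 => 1
  | 7, 1, 1 => 1
  | 7, 2, 2 => 2
  | 7, 3, 3 => 3
  | 7, 4, 4 => 4
  | 7, 5, 5 => 5
  | 7, 6, 6 => 6
  | 8, 2, 2 => 1
  | 8, 3, 3 => 1
  | 8, 4, 4 => 1
  | 8, 5, 5 => 2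
  | 8, 6, 6 => 2
  | _, _, _ => 0

theorem isLieLaw_structConst {n : ℕ} (t : ℕ → ℕ → ℕ → ℤ)
    (h : ∀ i j k l : Fin n, ∑ m, (structConst n t j k m * structConst n t i m l
      + structConst n t k i m * structConst n t j m l
      + structConst n t i j m * structConst n t k m l) = 0) :
    IsLieLaw (structConst n t) :=
  ⟨fun i j k => by simp only [structConst]; ring, h⟩

theorem isLieLaw_N66 : IsLieLaw (structConst 6 tableN66) :=
  isLieLaw_structConst _ (by decide +kernel)

theorem isLieLaw_N67 : IsLieLaw (structConst 6 tableN67) :=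
  isLieLaw_structConst _ (by decide +kernel)

theorem isLieLaw_G1 : IsLieLaw (structConst 8 tableG1) :=
  isLieLaw_structConst _ (by decide +kernel)

theorem isLieLaw_G2 : IsLieLaw (structConst 8 tableG2) :=
  isLieLaw_structConst _ (by decide +kernel)

/-- The real nilpotent law `N_{6,6}`. -/
noncomputable def lawN66 : LieLaw ℝ 6 := lawOfTable ℝ tableN66 isLieLaw_N66

/-- The real nilpotent law `N_{6,7}`. -/
noncomputable def lawN67 : LieLaw ℝ 6 := lawOfTable ℝ tableN67 isLieLaw_N67

/-- The real law `ĝ₁`. -/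
noncomputable def lawG1 : LieLaw ℝ 8 := lawOfTable ℝ tableG1 isLieLaw_G1

/-- The real law `ĝ₂`. -/
noncomputable def lawG2 : LieLaw ℝ 8 := lawOfTable ℝ tableG2 isLieLaw_G2

/-- The complex law `r₈²²`, which has the same structure constants as `ĝ₂`. -/
noncomputable def lawR822 : LieLaw ℂ 8 := lawOfTable ℂ tableG2 isLieLaw_G2

/-! Everything is deduced from one finite computation for each bracket table: every adjoint
2-cocycle is a coboundary. Vanishing of `H²` is then immediate, and rigidity is the
Nijenhuis–Richardson theorem, proved in `LieLaw.isRigid_of_cocyclesAreCoboundaries`. For a law `μ`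
and a linear complement `C` of the coboundaries, consider the map sending `(g, d)`, with `d ∈ C`, to
`g⁻¹ (μ + d)(g ·, g ·)`. Its derivative at `(1, 0)` is `(A, d) ↦ δA + d`, which is surjective, so
every array near `μ` is a value of the map near `(1, 0)`. If that array is a Lie law, so is `μ + d`.
The linearized relations at `μ` then take the quadratic value `-J(d)` on `d`; being injective on
`C`, because cocycles are coboundaries, they force a small `d` to vanish. The array therefore lies
in the orbit of `μ`.

The computation is feasible because `ad X₇` is diagonal with integral weights. Cartan's formula
shows that, modulo coboundaries, a cocycle has weight zero, which leaves 31 unknown entries for `ĝ₁`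
and 20 for `ĝ₂`. An explicit coboundary kills some of them and the cocycle relations kill the rest.
Derivations are treated in the same way, which gives completeness. The calculation uses only
characteristic zero, so the one for `ĝ₂` also serves `r₈²²`.

The nilradical is the span of `X₁, …, X₆`: an element of a nilpotent ideal acts nilpotently, and the
eigenvalues on the `X₁, X₂` coordinates detect its components along `X₇` and `X₈`. In `ĝ₁`, `ad X₈`
rotates the plane of `X₁` and `X₂`; over `ℂ` its eigenvectors `X₁ ∓ iX₂` play the role of the
generators `X₁, X₂` of `r₈²²`. This gives the real form, and the eigenvalues `±i` rule out complete
solvability. -/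

/-! ### Structure constants and bilinear maps -/

section StructureConstants

variable {K : Type*} [Field K] {n : ℕ}

/-- The bilinear map on `K^n` with the given structure constants. -/
def bilinOfConst (c : Fin n → Fin n → Fin n → K) :
    (Fin n → K) →ₗ[K] (Fin n → K) →ₗ[K] (Fin n → K) :=
  LinearMap.mk₂ K (fun x y k => ∑ i, ∑ j, x i * y j * c i j k)
    (fun x y z => by funext k; simp only [Pi.add_apply, add_mul, Finset.sum_add_distrib])
    (fun t x y => by
      funext k
      simp only [Pi.smul_apply, smul_eq_mul, Finset.mul_sum, mul_assoc])
    (fun x y z => by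
      funext k; simp only [Pi.add_apply, mul_add, add_mul, Finset.sum_add_distrib])
    (fun t x y => by
      funext k
      simp only [Pi.smul_apply, smul_eq_mul, Finset.mul_sum]
      exact Finset.sum_congr rfl fun i _ => Finset.sum_congr rfl fun j _ => by ring)

theorem bilinOfConst_apply (c : Fin n → Fin n → Fin n → K) (x y : Fin n → K) (k : Fin n) :
    bilinOfConst c x y k = ∑ i, ∑ j, x i * y j * c i j k := rfl

theorem bilinOfConst_single_left (c : Fin n → Fin n → Fin n → K) (i : Fin n) (y : Fin n → K)
    (k : Fin n) : bilinOfConst c (Pi.single i 1) y k = ∑ m, y m * c i m k := by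
  rw [bilinOfConst_apply, Finset.sum_eq_single i]
  · simp
  · intro b _ hb; simp [hb]
  · simp

theorem bilinOfConst_single_right (c : Fin n → Fin n → Fin n → K) (x : Fin n → K) (j : Fin n)
    (k : Fin n) : bilinOfConst c x (Pi.single j 1) k = ∑ m, x m * c m j k := by
  rw [bilinOfConst_apply]
  refine Finset.sum_congr rfl fun m _ => ?_
  rw [Finset.sum_eq_single j]
  · simp
  · intro b _ hb; simp [hb]
  · simp

@[simp]
theorem bilinOfConst_single_single (c : Fin n → Fin n → Fin n → K) (i j k : Fin n) :
    bilinOfConst c (Pi.single i 1) (Pi.single j 1) k = c i j k := by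
  rw [bilinOfConst_single_left, Finset.sum_eq_single j]
  · simp
  · intro b _ hb; simp [hb]
  · simp

theorem bilinOfConst_eq_of_basis {c : Fin n → Fin n → Fin n → K}
    {B : (Fin n → K) →ₗ[K] (Fin n → K) →ₗ[K] (Fin n → K)}
    (h : ∀ i j k, c i j k = B (Pi.single i 1) (Pi.single j 1) k) : bilinOfConst c = B := by
  refine LinearMap.ext_basis (Pi.basisFun K (Fin n)) (Pi.basisFun K (Fin n)) fun i j => ?_
  funext k
  simp [h]

/-- The Jacobi identity on basis vectors, in terms of structure constants. -/
theorem bilinOfConst_jacobi_basis (c : Fin n → Fin n → Fin n → K) (i j k l : Fin n) :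
    (bilinOfConst c (Pi.single i 1) (bilinOfConst c (Pi.single j 1) (Pi.single k 1)) +
      bilinOfConst c (Pi.single j 1) (bilinOfConst c (Pi.single k 1) (Pi.single i 1)) +
      bilinOfConst c (Pi.single k 1) (bilinOfConst c (Pi.single i 1) (Pi.single j 1))) l =
      ∑ m, (c j k m * c i m l + c k i m * c j m l + c i j m * c k m l) := by
  rw [Pi.add_apply, Pi.add_apply, bilinOfConst_single_left, bilinOfConst_single_left,
    bilinOfConst_single_left]
  simp only [bilinOfConst_single_single, Finset.sum_add_distrib]

theorem isLieLaw_of_bilinOfConst {c : Fin n → Fin n → Fin n → K}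
    (hs : ∀ x y, bilinOfConst c x y = -bilinOfConst c y x)
    (hj : ∀ x y z, bilinOfConst c x (bilinOfConst c y z) + bilinOfConst c y (bilinOfConst c z x) +
      bilinOfConst c z (bilinOfConst c x y) = 0) : IsLieLaw c := by
  refine ⟨fun i j k => ?_, fun i j k l => ?_⟩
  · simpa using congrFun (hs (Pi.single i 1) (Pi.single j 1)) k
  · rw [← bilinOfConst_jacobi_basis, hj]
    rfl

/-- The structure constants of the bilinear map `g (c (g⁻¹ ·, g⁻¹ ·))`. -/
def transportConst (g : (Fin n → K) ≃ₗ[K] (Fin n → K)) (c : Fin n → Fin n → Fin n → K) :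
    Fin n → Fin n → Fin n → K :=
  fun i j => g (bilinOfConst c (g.symm (Pi.single i 1)) (g.symm (Pi.single j 1)))

theorem bilinOfConst_transportConst (g : (Fin n → K) ≃ₗ[K] (Fin n → K))
    (c : Fin n → Fin n → Fin n → K) (x y : Fin n → K) :
    bilinOfConst (transportConst g c) x y = g (bilinOfConst c (g.symm x) (g.symm y)) := by
  have h : bilinOfConst (transportConst g c) =
      ((bilinOfConst c).compl₁₂ g.symm.toLinearMap g.symm.toLinearMap).compr₂ g.toLinearMap :=
    bilinOfConst_eq_of_basis fun i j k => rfl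
  rw [h]
  rfl

theorem isLieLaw_transportConst [CharZero K] (g : (Fin n → K) ≃ₗ[K] (Fin n → K))
    {c : Fin n → Fin n → Fin n → K} (hc : IsLieLaw c) : IsLieLaw (transportConst g c) := by
  refine isLieLaw_of_bilinOfConst (fun x y => ?_) fun x y z => ?_
  · rw [bilinOfConst_transportConst, bilinOfConst_transportConst, ← map_neg]
    exact congrArg g (LieLaw.bracket_skew ⟨c, hc⟩ _ _)
  · simp only [bilinOfConst_transportConst, LinearEquiv.symm_apply_apply]
    rw [← map_add, ← map_add]
    exact (congrArg g (LieLaw.bracket_jacobi ⟨c, hc⟩ _ _ _)).trans (map_zero g)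

theorem isLieLaw_of_transportConst [CharZero K] (g : (Fin n → K) ≃ₗ[K] (Fin n → K))
    {c : Fin n → Fin n → Fin n → K} (hc : IsLieLaw (transportConst g c)) : IsLieLaw c := by
  have h : transportConst g.symm (transportConst g c) = c := by
    funext i j k
    rw [transportConst, bilinOfConst_transportConst]
    simp
  rw [← h]
  exact isLieLaw_transportConst _ hc

/-- The coboundary of the linear endomorphism of `K^n` that maps the basis vector `i` to the vector
with coordinates `f i`, as an array of structure constants. -/
def coboundaryConst (c : Fin n → Fin n → Fin n → K) (f : Fin n → Fin n → K) :
    Fin n → Fin n → Fin n → K :=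
  fun i j k => ∑ m, (f j m * c i m k + f i m * c m j k - c i j m * f m k)

/-- The array `φ` gives the values on basis vectors of a `2`-cocycle of the law `c`. -/
def IsCocycleConst (c φ : Fin n → Fin n → Fin n → K) : Prop :=
  (∀ i j k, φ i j k = -φ j i k) ∧
    ∀ i j k l, ∑ m, ((c j k m * φ i m l + φ j k m * c i m l) +
      (c k i m * φ j m l + φ k i m * c j m l) + (c i j m * φ k m l + φ i j m * c k m l)) = 0

/-- Every `2`-cocycle of the law `c` is a `2`-coboundary. -/
def CocyclesAreCoboundaries (c : Fin n → Fin n → Fin n → K) : Prop :=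
  ∀ φ, IsCocycleConst c φ → ∃ f, φ = coboundaryConst c f

end StructureConstants

namespace LieLaw

variable {K : Type*} [Field K] [CharZero K] {n : ℕ}

theorem lie_def (μ : LieLaw K n) (x y : μ.Alg) : ⁅x, y⁆ = bilinOfConst μ.1 x y := rfl

/-- The standard basis of `(K^n, μ)`. -/
noncomputable def basis (μ : LieLaw K n) : Module.Basis (Fin n) K μ.Alg := Pi.basisFun K (Fin n)

theorem basis_apply (μ : LieLaw K n) (i : Fin n) :
    μ.basis i = (Pi.single i 1 : Fin n → K) := Pi.basisFun_apply K (Fin n) i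

theorem sum_smul_basis (μ : LieLaw K n) (x : μ.Alg) : ∑ i, (x i : K) • μ.basis i = x :=
  (Pi.basisFun K (Fin n)).sum_repr x

theorem sum_smul_apply (μ : LieLaw K n) {ι : Type*} (s : Finset ι) (a : ι → K) (x : ι → μ.Alg)
    (k : Fin n) : (∑ i ∈ s, a i • x i) k = ∑ i ∈ s, a i * x i k :=
  (Finset.sum_apply k s fun i => (a i • x i : Fin n → K)).trans rfl

theorem lie_basis_basis (μ : LieLaw K n) (i j k : Fin n) : ⁅μ.basis i, μ.basis j⁆ k = μ.1 i j k := by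
  rw [lie_def, basis_apply, basis_apply]
  exact bilinOfConst_single_single _ _ _ _

theorem lie_basis_left (μ : LieLaw K n) (i : Fin n) (x : μ.Alg) (k : Fin n) :
    ⁅μ.basis i, x⁆ k = ∑ m, x m * μ.1 i m k := by
  rw [lie_def, basis_apply]
  exact bilinOfConst_single_left _ _ _ _

theorem map_apply_eq_sum (μ : LieLaw K n) (f : μ.Alg →ₗ[K] μ.Alg) (x : μ.Alg) (k : Fin n) :
    f x k = ∑ m, x m * f (μ.basis m) k := by
  conv_lhs => rw [← μ.sum_smul_basis x]
  rw [map_sum]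
  simp only [map_smul]
  exact μ.sum_smul_apply _ _ _ k

theorem finrank_alg (μ : LieLaw K n) : Module.finrank K μ.Alg = n := by
  rw [Module.finrank_eq_card_basis μ.basis, Fintype.card_fin]

/-! ### Cochains as arrays of structure constants -/

open LieModule.Cohomology

theorem isCocycleConst_of_mem_twoCocycle (μ : LieLaw K n) {a : twoCochain K μ.Alg μ.Alg}
    (ha : a ∈ twoCocycle K μ.Alg μ.Alg) :
    IsCocycleConst μ.1 fun i j k => a (μ.basis i) (μ.basis j) k := by
  refine ⟨fun i j k => ?_, fun i j k l => ?_⟩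
  · exact congrFun (twoCochain_skew a (μ.basis j) (μ.basis i)).symm k
  · rw [mem_twoCocycle_iff] at ha
    have h := DFunLike.congr_fun (DFunLike.congr_fun (DFunLike.congr_fun ha (μ.basis i))
      (μ.basis j)) (μ.basis k)
    rw [d₂₃_apply] at h
    -- `d₂₃` is an alternating sum; skew-symmetry of the cochain and of the bracket rotates its
    -- terms into the cyclic form of `IsCocycleConst`.
    rw [← twoCochain_skew a (μ.basis k) ⁅μ.basis i, μ.basis j⁆,
      ← twoCochain_skew a (μ.basis j) ⁅μ.basis i, μ.basis k⁆,
      ← twoCochain_skew a (μ.basis i) ⁅μ.basis j, μ.basis k⁆,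
      ← lie_skew (μ.basis i) (μ.basis k), ← twoCochain_skew a (μ.basis k) (μ.basis i), lie_neg,
      map_neg] at h
    have hl := congrFun h l
    have e (x y z : Fin n) : a (μ.basis x) ⁅μ.basis y, μ.basis z⁆ l =
        ∑ m, μ.1 y z m * a (μ.basis x) (μ.basis m) l := by
      rw [show a (μ.basis x) ⁅μ.basis y, μ.basis z⁆ l = a.1 (μ.basis x) ⁅μ.basis y, μ.basis z⁆ l
        from rfl, map_apply_eq_sum]
      simp only [lie_basis_basis]
      rfl
    simp only [Finset.sum_add_distrib]
    rw [← e, ← e, ← e, ← lie_basis_left, ← lie_basis_left, ← lie_basis_left]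
    refine Eq.trans ?_ hl
    change _ = ⁅μ.basis i, a (μ.basis j) (μ.basis k)⁆ l
      - (-⁅μ.basis j, a (μ.basis k) (μ.basis i)⁆ l) + ⁅μ.basis k, a (μ.basis i) (μ.basis j)⁆ l
      - (-a (μ.basis k) ⁅μ.basis i, μ.basis j⁆ l) + (- (-a (μ.basis j) ⁅μ.basis k, μ.basis i⁆ l))
      - (-a (μ.basis i) ⁅μ.basis j, μ.basis k⁆ l)
    ring

/-- The endomorphism mapping the basis vector `i` to the vector with coordinates `f i`. -/
noncomputable def endOfConst (μ : LieLaw K n) (f : Fin n → Fin n → K) : μ.Alg →ₗ[K] μ.Alg :=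
  μ.basis.constr K f

theorem endOfConst_basis (μ : LieLaw K n) (f : Fin n → Fin n → K) (i : Fin n) :
    μ.endOfConst f (μ.basis i) = f i := μ.basis.constr_basis K f i

theorem d₁₂_endOfConst_basis (μ : LieLaw K n) (f : Fin n → Fin n → K) (i j k : Fin n) :
    (d₁₂ K μ.Alg μ.Alg (μ.endOfConst f)) (μ.basis i) (μ.basis j) k =
      coboundaryConst μ.1 f i j k := by
  rw [d₁₂_apply_apply]
  change ⁅μ.basis i, μ.endOfConst f (μ.basis j)⁆ k -
    ⁅μ.basis j, μ.endOfConst f (μ.basis i)⁆ k - μ.endOfConst f ⁅μ.basis i, μ.basis j⁆ k = _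
  rw [map_apply_eq_sum, lie_basis_left, lie_basis_left, ← Finset.sum_sub_distrib,
    ← Finset.sum_sub_distrib, coboundaryConst]
  refine Finset.sum_congr rfl fun m _ => ?_
  rw [endOfConst_basis, endOfConst_basis, endOfConst_basis, lie_basis_basis, μ.2.1 j m k]
  ring

/-- This is `d ∘ d = 0`, imported from the cochain complex instead of being recomputed with indices.
-/
theorem isCocycleConst_coboundaryConst (μ : LieLaw K n) (f : Fin n → Fin n → K) :
    IsCocycleConst μ.1 (coboundaryConst μ.1 f) := by
  have h : d₁₂ K μ.Alg μ.Alg (μ.endOfConst f) ∈ twoCocycle K μ.Alg μ.Alg :=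
    (mem_twoCocycle_iff ..).2 (LinearMap.congr_fun (d₂₃_comp_d₁₂ K μ.Alg μ.Alg) _)
  have h' := μ.isCocycleConst_of_mem_twoCocycle h
  simpa only [d₁₂_endOfConst_basis] using h'

theorem subsingleton_h2Adjoint (μ : LieLaw K n) (h : CocyclesAreCoboundaries μ.1) :
    Subsingleton (H2Adjoint K μ.Alg) := by
  rw [Submodule.Quotient.subsingleton_iff, Submodule.eq_top_iff']
  rintro ⟨a, ha⟩
  obtain ⟨f, hf⟩ := h _ (μ.isCocycleConst_of_mem_twoCocycle ha)
  change a ∈ LinearMap.range (d₁₂ K μ.Alg μ.Alg)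
  refine ⟨μ.endOfConst f,
    Subtype.ext (LinearMap.ext_basis μ.basis μ.basis fun i j => funext fun k => ?_)⟩
  exact (μ.d₁₂_endOfConst_basis f i j k).trans (congrFun (congrFun (congrFun hf i) j) k).symm

end LieLaw

/-! ### Vanishing of `H²` implies rigidity -/

section Rigidity

open Filter Topology

variable {K : Type*} [NontriviallyNormedField K] {n : ℕ}

/-- The quadratic map `c ↦ J(c)` whose zeros are the arrays satisfying the Jacobi relations. -/
def jacobiConst (c : Fin n → Fin n → Fin n → K) (i j k l : Fin n) : K :=
  ∑ m, (c j k m * c i m l + c k i m * c j m l + c i j m * c k m l)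

/-- The linear map sending `φ` to the linearizations at `c` of the skew-symmetry and Jacobi
relations. -/
def linearizedRelations (c : Fin n → Fin n → Fin n → K) :
    (Fin n → Fin n → Fin n → K) →ₗ[K]
      (Fin n → Fin n → Fin n → K) × (Fin n → Fin n → Fin n → Fin n → K) where
  toFun φ := (fun i j k => φ i j k + φ j i k, fun i j k l =>
    ∑ m, ((c j k m * φ i m l + φ j k m * c i m l) + (c k i m * φ j m l + φ k i m * c j m l) +
      (c i j m * φ k m l + φ i j m * c k m l)))
  map_add' φ ψ := by
    refine Prod.ext ?_ ?_
    · funext i j k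
      simp only [Pi.add_apply, Prod.fst_add]
      ring
    · funext i j k l
      simp only [Pi.add_apply, Prod.snd_add, ← Finset.sum_add_distrib]
      exact Finset.sum_congr rfl fun m _ => by ring
  map_smul' t φ := by
    refine Prod.ext ?_ ?_
    · funext i j k
      simp only [Pi.smul_apply, smul_eq_mul, RingHom.id_apply, Prod.smul_fst]
      ring
    · funext i j k l
      simp only [Pi.smul_apply, smul_eq_mul, RingHom.id_apply, Prod.smul_snd, Finset.mul_sum]
      exact Finset.sum_congr rfl fun m _ => by ring

theorem isCocycleConst_of_linearizedRelations_eq_zero {c φ : Fin n → Fin n → Fin n → K}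
    (h : linearizedRelations c φ = 0) : IsCocycleConst c φ :=
  ⟨fun i j k => eq_neg_of_add_eq_zero_left
      (congrFun (congrFun (congrFun (congrArg Prod.fst h) i) j) k),
    fun i j k l => congrFun (congrFun (congrFun (congrFun (congrArg Prod.snd h) i) j) k) l⟩

/-- The Jacobi relations are homogeneous quadratic, so expanding at `c + d` leaves the linear part
plus `jacobiConst d`. Skew-symmetry is linear and leaves no remainder. -/
theorem linearizedRelations_of_isLieLaw {c d : Fin n → Fin n → Fin n → K}
    (hc : IsLieLaw c) (hd : IsLieLaw (c + d)) :
    linearizedRelations c d = (0, -jacobiConst d) := by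
  refine Prod.ext ?_ ?_
  · funext i j k
    have h1 := hc.1 i j k
    have h2 := hd.1 i j k
    simp only [Pi.add_apply] at h2
    change d i j k + d j i k = 0
    linear_combination h2 - h1
  · funext i j k l
    have h1 := hc.2 i j k l
    have h2 := hd.2 i j k l
    have h3 : (∑ m, ((c + d) j k m * (c + d) i m l + (c + d) k i m * (c + d) j m l +
        (c + d) i j m * (c + d) k m l)) =
        ∑ m, (c j k m * c i m l + c k i m * c j m l + c i j m * c k m l) +
        (linearizedRelations c d).2 i j k l + jacobiConst d i j k l := by
      simp only [linearizedRelations, jacobiConst, LinearMap.coe_mk, AddHom.coe_mk, Pi.add_apply]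
      rw [← Finset.sum_add_distrib, ← Finset.sum_add_distrib]
      exact Finset.sum_congr rfl fun m _ => by ring
    rw [h2, h1] at h3
    change (linearizedRelations c d).2 i j k l = -jacobiConst d i j k l
    linear_combination -h3

theorem norm_jacobiConst_le (d : Fin n → Fin n → Fin n → K) :
    ‖jacobiConst d‖ ≤ 3 * n * ‖d‖ * ‖d‖ := by
  have hd (i j k : Fin n) : ‖d i j k‖ ≤ ‖d‖ :=
    (norm_le_pi_norm _ k).trans ((norm_le_pi_norm _ j).trans (norm_le_pi_norm d i))
  have hm (i j k i' j' k' : Fin n) : ‖d i j k * d i' j' k'‖ ≤ ‖d‖ * ‖d‖ :=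
    (norm_mul_le _ _).trans (mul_le_mul (hd _ _ _) (hd _ _ _) (norm_nonneg _) (norm_nonneg _))
  have hr : 0 ≤ 3 * n * ‖d‖ * ‖d‖ := by positivity
  refine (pi_norm_le_iff_of_nonneg hr).2 fun i => (pi_norm_le_iff_of_nonneg hr).2 fun j =>
    (pi_norm_le_iff_of_nonneg hr).2 fun k => (pi_norm_le_iff_of_nonneg hr).2 fun l => ?_
  refine (norm_sum_le _ _).trans ((Finset.sum_le_card_nsmul _ _ (3 * (‖d‖ * ‖d‖))
    fun m _ => ?_).trans (le_of_eq ?_))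
  · refine (norm_add₃_le).trans ?_
    linarith [hm j k m i m l, hm k i m j m l, hm i j m k m l]
  · simp
    ring

/-- Near a law, the elements of a complement of the coboundaries that are translates of Lie laws
vanish when the cocycles are coboundaries. -/
theorem eventually_eq_zero_of_isLieLaw_add [CompleteSpace K] {c : Fin n → Fin n → Fin n → K}
    (hc : IsLieLaw c) (C : Submodule K (Fin n → Fin n → Fin n → K))
    (hC : ∀ d ∈ C, IsCocycleConst c d → d = 0) :
    ∀ᶠ d : C in 𝓝 0, IsLieLaw (c + d.1) → d = 0 := by
  -- On `C` the linearized relations are injective, hence bounded below by finite dimensionality.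
  let T : C →ₗ[K] _ := (linearizedRelations c).comp C.subtype
  have hT : LinearMap.ker T = ⊥ := by
    refine LinearMap.ker_eq_bot'.2 fun d hd => Subtype.ext ?_
    exact hC d.1 d.2 (isCocycleConst_of_linearizedRelations_eq_zero hd)
  obtain ⟨k, hk, hTk⟩ := T.exists_antilipschitzWith hT
  have hk' : (0 : ℝ) < k := hk
  -- Combining `‖d‖ ≤ k ‖T d‖` with `‖T d‖ ≤ 3n ‖d‖²` excludes `0 < ‖d‖` once `3nk ‖d‖ < 1`. The
  -- extra `1` keeps the denominator positive when `n = 0`.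
  have hr : (0 : ℝ) < 1 / (k * (3 * n + 1)) := by positivity
  filter_upwards [Metric.ball_mem_nhds (0 : C) hr] with d hd hL
  rw [mem_ball_zero_iff] at hd
  by_contra h0
  have hpos : 0 < ‖d‖ := norm_pos_iff.2 h0
  have h1 : ‖d‖ ≤ k * ‖T d‖ := by
    simpa only [LinearMap.map_zero, dist_zero_right] using hTk.le_mul_dist d 0
  have h2 : ‖T d‖ ≤ 3 * n * ‖d‖ * ‖d‖ := by
    have : T d = (0, -jacobiConst d.1) := linearizedRelations_of_isLieLaw hc hL
    rw [this, Prod.norm_mk, norm_zero, norm_neg, max_eq_right (norm_nonneg _)]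
    exact norm_jacobiConst_le d.1
  rw [lt_div_iff₀ (by positivity)] at hd
  have h3 : ‖d‖ ≤ k * (3 * n * ‖d‖ * ‖d‖) := h1.trans (mul_le_mul_of_nonneg_left h2 hk'.le)
  have h4 : ‖d‖ * (‖d‖ * (k * (3 * n + 1))) < ‖d‖ * 1 := mul_lt_mul_of_pos_left hd hpos
  nlinarith [mul_pos hk' (mul_pos hpos hpos)]

/-- Coboundaries as a linear map on endomorphisms. -/
def coboundaryLinear (c : Fin n → Fin n → Fin n → K) :
    (Fin n → Fin n → K) →ₗ[K] (Fin n → Fin n → Fin n → K) where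
  toFun f := coboundaryConst c f
  map_add' f g := by
    funext i j k
    simp only [coboundaryConst, Pi.add_apply, ← Finset.sum_add_distrib]
    exact Finset.sum_congr rfl fun m _ => by ring
  map_smul' t f := by
    funext i j k
    simp only [coboundaryConst, Pi.smul_apply, smul_eq_mul, RingHom.id_apply, Finset.mul_sum]
    exact Finset.sum_congr rfl fun m _ => by ring

/-- The vector of structure constants `B (g u, g v)`, for the bilinear map `B` with structure
constants `c`. -/
def pullbackConst (c : Fin n → Fin n → Fin n → K) (g : (Fin n → K) →L[K] (Fin n → K))
    (i j : Fin n) : Fin n → K :=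
  fun k => ∑ a, ∑ b, g (Pi.single i 1) a * g (Pi.single j 1) b * c a b k

/-- Each coordinate is a cubic polynomial in continuous linear or affine functions of `(g, d)`, so
the product rule applies; at `(1, 0)` the coordinates of `g` become Kronecker deltas and the double
sums collapse. -/
theorem hasStrictFDerivAt_pullbackConst [CompleteSpace K] (c : Fin n → Fin n → Fin n → K)
    (C : Submodule K (Fin n → Fin n → Fin n → K)) (i j : Fin n) :
    ∃ D : (((Fin n → K) →L[K] (Fin n → K)) × C) →L[K] (Fin n → K),
      HasStrictFDerivAt (fun p : ((Fin n → K) →L[K] (Fin n → K)) × C =>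
        pullbackConst (c + p.2.1) p.1 i j) D (1, 0) ∧
      ∀ A d k, D (A, d) k = ∑ m, (A (Pi.single j 1) m * c i m k + A (Pi.single i 1) m * c m j k) +
        d.1 i j k := by
  obtain ⟨coord, hcoord⟩ : ∃ coord : Fin n → Fin n → (((Fin n → K) →L[K] (Fin n → K)) × C) →L[K] K,
      ∀ i a A d, coord i a (A, d) = A (Pi.single i 1) a :=
    ⟨fun i a => (ContinuousLinearMap.proj (R := K) (φ := fun _ : Fin n => K) a).comp ((ContinuousLinearMap.apply K (Fin n → K)
      (Pi.single i 1 : Fin n → K)).comp (ContinuousLinearMap.fst K _ C)), fun _ _ _ _ => rfl⟩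
  obtain ⟨entry, hentry⟩ : ∃ entry : Fin n → Fin n → Fin n →
      (((Fin n → K) →L[K] (Fin n → K)) × C) →L[K] K, ∀ a b k A d, entry a b k (A, d) = d.1 a b k :=
    ⟨fun a b k => (ContinuousLinearMap.proj k).comp ((ContinuousLinearMap.proj b).comp
      ((ContinuousLinearMap.proj a).comp (C.subtypeL.comp (ContinuousLinearMap.snd K _ C)))),
      fun _ _ _ _ _ => rfl⟩
  have hk (k a b : Fin n) := (((coord i a).hasStrictFDerivAt (x := (1, 0))).mul
    ((coord j b).hasStrictFDerivAt (x := (1, 0)))).mul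
    (((entry a b k).hasStrictFDerivAt (x := (1, 0))).const_add (c a b k))
  have hsum (k : Fin n) := HasStrictFDerivAt.fun_sum (u := Finset.univ) fun a _ =>
    HasStrictFDerivAt.fun_sum (u := Finset.univ) fun b _ => hk k a b
  refine ⟨_, (hasStrictFDerivAt_pi.2 hsum).congr_of_eventuallyEq ?_, fun A d k => ?_⟩
  · refine Eventually.of_forall fun p => funext fun k => ?_
    simp only [pullbackConst, Pi.mul_apply, Pi.add_apply]
    exact Finset.sum_congr rfl fun a _ => Finset.sum_congr rfl fun b _ => by
      rw [← hcoord i a p.1 p.2, ← hcoord j b p.1 p.2, ← hentry a b k p.1 p.2]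
  · simp [hcoord, hentry, Pi.single_apply, Finset.sum_add_distrib, mul_comm]
    ring

/-- Differentiating the outer inverse contributes `-A (c i j)`, the missing term of the coboundary
of `A`. Using `Ring.inverse` makes the map total on a normed space, so no chart on `GL(n, K)` is
needed. -/
theorem exists_hasStrictFDerivAt_pullback [CompleteSpace K] (c : Fin n → Fin n → Fin n → K)
    (C : Submodule K (Fin n → Fin n → Fin n → K)) :
    ∃ D : (((Fin n → K) →L[K] (Fin n → K)) × C) →L[K] (Fin n → Fin n → Fin n → K),
      HasStrictFDerivAt (fun p : ((Fin n → K) →L[K] (Fin n → K)) × C => fun i j =>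
        Ring.inverse p.1 (pullbackConst (c + p.2.1) p.1 i j)) D (1, 0) ∧
      ∀ A d, D (A, d) = coboundaryConst c (fun i => A (Pi.single i 1)) + d.1 := by
  choose D hD hDapp using hasStrictFDerivAt_pullbackConst c C
  have hinv : HasStrictFDerivAt
      (fun p : ((Fin n → K) →L[K] (Fin n → K)) × C => Ring.inverse p.1) _ (1, 0) :=
    HasStrictFDerivAt.comp (x := ((1, 0) : ((Fin n → K) →L[K] (Fin n → K)) × C))
      (f := Prod.fst) (g := Ring.inverse) (hasStrictFDerivAt_ringInverse (𝕜 := K) 1)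
      hasStrictFDerivAt_fst
  refine ⟨_, hasStrictFDerivAt_pi.2 fun i => hasStrictFDerivAt_pi.2 fun j =>
    hinv.clm_apply (hD i j), fun A d => ?_⟩
  funext i j k
  have h1 : pullbackConst c (1 : (Fin n → K) →L[K] (Fin n → K)) i j = c i j := by
    funext k
    simp [pullbackConst, Pi.single_apply]
  have hA : A (c i j) k = ∑ m, c i j m * A (Pi.single m 1) k := by
    conv_lhs => rw [← Finset.univ_sum_single (c i j)]
    rw [map_sum, Finset.sum_apply]
    refine Finset.sum_congr rfl fun m _ => ?_
    rw [show (Pi.single m (c i j m) : Fin n → K) = c i j m • Pi.single m 1 by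
      rw [← Pi.single_smul, smul_eq_mul, mul_one], map_smul]
    rfl
  simp [hDapp, h1, hA, coboundaryConst, Finset.sum_sub_distrib, Finset.sum_add_distrib]
  ring

theorem continuous_transportConst (g : (Fin n → K) ≃ₗ[K] (Fin n → K)) [CompleteSpace K] :
    Continuous (transportConst g :
      (Fin n → Fin n → Fin n → K) → Fin n → Fin n → Fin n → K) := by
  refine continuous_pi fun i => continuous_pi fun j => ?_
  refine (LinearMap.continuous_of_finiteDimensional g.toLinearMap).comp (continuous_pi fun k => ?_)
  change Continuous fun c : Fin n → Fin n → Fin n → K =>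
    ∑ a, ∑ b, g.symm (Pi.single i 1) a * g.symm (Pi.single j 1) b * c a b k
  refine continuous_finsetSum _ fun a _ => continuous_finsetSum _ fun b _ =>
    continuous_const.mul ?_
  exact continuous_pi_iff.1 (continuous_pi_iff.1 (continuous_apply a) b) k

variable [CharZero K]

/-! ### The action of `GL(n, K)` and the rigidity criterion -/

namespace LieLaw

/-- The action of `GL(n, K)` on laws. -/
def transport (g : (Fin n → K) ≃ₗ[K] (Fin n → K)) (μ : LieLaw K n) : LieLaw K n :=
  ⟨transportConst g μ.1, isLieLaw_transportConst g μ.2⟩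

theorem bracket_transport (g : (Fin n → K) ≃ₗ[K] (Fin n → K)) (μ : LieLaw K n) (x y : Fin n → K) :
    (transport g μ).bracket x y = g (μ.bracket (g.symm x) (g.symm y)) :=
  bilinOfConst_transportConst g μ.1 x y

theorem eq_of_bracket_eq {μ ν : LieLaw K n} (h : ∀ x y, μ.bracket x y = ν.bracket x y) :
    μ = ν := by
  refine Subtype.ext (funext fun i => funext fun j => funext fun k => ?_)
  rw [← bilinOfConst_single_single μ.1, ← bilinOfConst_single_single ν.1]
  exact congrFun (h _ _) k

/-- The group acts continuously and transitively on the orbit, so being a neighbourhood of one point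
propagates to all points by translation. -/
theorem isRigid_of_orbit_mem_nhds [CompleteSpace K] {μ : LieLaw K n} (h : μ.orbit ∈ 𝓝 μ) :
    μ.IsRigid := by
  refine isOpen_iff_mem_nhds.2 fun ν ⟨g, hg⟩ => ?_
  have hν : transport g.symm ν = μ := eq_of_bracket_eq fun x y => by
    rw [bracket_transport, hg]
    simp
  have hcont : Continuous (transport g.symm : LieLaw K n → LieLaw K n) :=
    Continuous.subtype_mk ((continuous_transportConst g.symm).comp continuous_subtype_val) _
  refine Filter.mem_of_superset (hcont.continuousAt.preimage_mem_nhds (by rwa [hν])) ?_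
  rintro ρ ⟨g', hg'⟩
  refine ⟨g'.trans g, fun u v => ?_⟩
  have := hg' (g.symm u) (g.symm v)
  rw [bracket_transport] at this
  simp only [LinearEquiv.symm_symm, LinearEquiv.apply_symm_apply] at this
  exact (LinearEquiv.symm_apply_eq g).1 this

/-- A law whose `2`-cocycles are coboundaries is rigid. -/
theorem isRigid_of_cocyclesAreCoboundaries [CompleteSpace K] (μ : LieLaw K n)
    (h : CocyclesAreCoboundaries μ.1) : μ.IsRigid := by
  refine isRigid_of_orbit_mem_nhds ?_
  obtain ⟨C, hC⟩ := Submodule.exists_isCompl (LinearMap.range (coboundaryLinear μ.1))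
  have hCz : ∀ d ∈ C, IsCocycleConst μ.1 d → d = 0 := fun d hd hcoc => by
    obtain ⟨f, hf⟩ := h d hcoc
    exact (Submodule.disjoint_def.1 hC.disjoint) d ⟨f, hf.symm⟩ hd
  obtain ⟨D, hD, hDapp⟩ := exists_hasStrictFDerivAt_pullback μ.1 C
  -- The endomorphism component covers the coboundaries and the other component covers their
  -- complement.
  have hrange : D.range = ⊤ := by
    refine LinearMap.range_eq_top.2 fun φ => ?_
    obtain ⟨_, ⟨f, rfl⟩, d, hd, rfl⟩ :=
      Submodule.mem_sup.1 (hC.sup_eq_top ▸ Submodule.mem_top : φ ∈ _ ⊔ C)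
    refine ⟨(LinearMap.toContinuousLinearMap ((Pi.basisFun K (Fin n)).constr K f), ⟨d, hd⟩), ?_⟩
    refine (hDapp _ _).trans ?_
    congr 2
    funext i
    simp
  have := FiniteDimensional.complete K C
  have := FiniteDimensional.complete K ((Fin n → K) →L[K] (Fin n → K))
  -- Surjectivity of a strict derivative makes the map open at `(1, 0)`, so a property of all values
  -- near `(1, 0)` holds near `μ`.
  have hmap := hD.map_nhds_eq_of_surj hrange
  have hbase : (fun i j => Ring.inverse (1 : (Fin n → K) →L[K] (Fin n → K))
      (pullbackConst (μ.1 + ((0 : C) : Fin n → Fin n → Fin n → K)) 1 i j)) = μ.1 := by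
    funext i j k
    simp [pullbackConst, Pi.single_apply]
  have hev : ∀ᶠ p : ((Fin n → K) →L[K] (Fin n → K)) × C in 𝓝 (1, 0),
      ∀ ν : LieLaw K n, (ν.1 = fun i j => Ring.inverse p.1 (pullbackConst (μ.1 + p.2.1) p.1 i j)) →
        ν ∈ μ.orbit := by
    have hu : ∀ᶠ p : ((Fin n → K) →L[K] (Fin n → K)) × C in 𝓝 (1, 0), IsUnit p.1 :=
      continuous_fst.continuousAt.eventually (Units.isOpen.mem_nhds isUnit_one)
    have hz : ∀ᶠ p : ((Fin n → K) →L[K] (Fin n → K)) × C in 𝓝 (1, 0),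
        IsLieLaw (μ.1 + p.2.1) → p.2 = 0 :=
      (continuous_snd.tendsto (1, (0 : C))).eventually (eventually_eq_zero_of_isLieLaw_add μ.2 C hCz)
    filter_upwards [hu, hz]
    rintro ⟨_, d⟩ ⟨u, rfl⟩ hd ν hν
    let g : (Fin n → K) ≃ₗ[K] (Fin n → K) :=
      (ContinuousLinearEquiv.unitsEquiv K (Fin n → K) u).toLinearEquiv
    have hg : ν.1 = transportConst g.symm (μ.1 + d.1) := by
      rw [hν]
      funext i j
      rw [Ring.inverse_unit]
      rfl
    -- The array `μ + d` need not be a law a priori; it is one here because its transport `ν` is.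
    have hL : IsLieLaw (μ.1 + d.1) := isLieLaw_of_transportConst g.symm (hg ▸ ν.2)
    have hd0 : d = 0 := hd hL
    subst hd0
    refine ⟨g.symm, fun x y => ?_⟩
    rw [Submodule.coe_zero, add_zero] at hg
    rw [← bracket_transport]
    exact congrArg (fun c => bilinOfConst c x y) hg
  rw [nhds_subtype_eq_comap]
  have hmem : {c : Fin n → Fin n → Fin n → K | ∀ ν : LieLaw K n, ν.1 = c → ν ∈ μ.orbit} ∈ 𝓝 μ.1 := by
    rw [← hbase, ← hmap]
    exact hev
  exact Filter.mem_of_superset (Filter.preimage_mem_comap hmem) fun ν hν => hν ν rfl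

end LieLaw

end Rigidity

/-! ### Cocycles and derivations in the presence of a diagonal inner derivation -/

section Weights

variable {K : Type*} [Field K] {n : ℕ} {c : Fin n → Fin n → Fin n → K}

/-- The bracket with the basis vector `t` is diagonal, with eigenvalues `w`. -/
def IsDiagonalAt (c : Fin n → Fin n → Fin n → K) (t : Fin n) (w : Fin n → K) : Prop :=
  ∀ i k, c t i k = if i = k then w i else 0

theorem coboundaryConst_sub (c : Fin n → Fin n → Fin n → K) (f g : Fin n → Fin n → K) :
    coboundaryConst c (f - g) = coboundaryConst c f - coboundaryConst c g := by
  funext i j k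
  simp only [coboundaryConst, Pi.sub_apply, ← Finset.sum_sub_distrib]
  exact Finset.sum_congr rfl fun m _ => by ring

theorem coboundaryConst_add (c : Fin n → Fin n → Fin n → K) (f g : Fin n → Fin n → K) :
    coboundaryConst c (f + g) = coboundaryConst c f + coboundaryConst c g := by
  funext i j k
  simp only [coboundaryConst, Pi.add_apply, ← Finset.sum_add_distrib]
  exact Finset.sum_congr rfl fun m _ => by ring

theorem IsCocycleConst.sub {φ ψ : Fin n → Fin n → Fin n → K} (hφ : IsCocycleConst c φ)
    (hψ : IsCocycleConst c ψ) : IsCocycleConst c (φ - ψ) := by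
  refine ⟨fun i j k => ?_, fun i j k l => ?_⟩
  · simp only [Pi.sub_apply]
    linear_combination hφ.1 i j k - hψ.1 i j k
  · refine Eq.trans ?_ ((congrArg₂ (· - ·) (hφ.2 i j k l) (hψ.2 i j k l)).trans (sub_zero 0))
    rw [← Finset.sum_sub_distrib]
    exact Finset.sum_congr rfl fun m _ => by simp only [Pi.sub_apply]; ring

/-- Cartan's formula for the contraction of a cocycle with a diagonal basis vector. -/
theorem IsCocycleConst.weight_mul {φ : Fin n → Fin n → Fin n → K} (hc : IsLieLaw c)
    (hφ : IsCocycleConst c φ) {t : Fin n} {w : Fin n → K} (ht : IsDiagonalAt c t w)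
    (i j l : Fin n) : (w l - w i - w j) * φ i j l = coboundaryConst c (φ t) i j l := by
  -- With first argument `t`, three of the six sums are diagonal and give the weights; the others
  -- reassemble into the coboundary of the contraction, up to the term in `φ t` kept as it stands.
  have h := hφ.2 t i j l
  have h1 : ∑ m, c t i m * φ j m l = w i * φ j i l := by simp [ht i]
  have h2 : ∑ m, c j t m * φ i m l = -(w j * φ i j l) := by
    simp [hc.1 j t, ht j]
  have h3 : ∑ m, φ i j m * c t m l = φ i j l * w l := by simp [fun m => ht m l]
  have h4 : ∑ m, φ j t m * c i m l = -∑ m, φ t j m * c i m l := by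
    simp [hφ.1 j t]
  have h5 : ∑ m, φ t i m * c j m l = -∑ m, φ t i m * c m j l := by
    simp [fun m => hc.1 j m l]
  simp only [Finset.sum_add_distrib] at h
  rw [h1, h2, h3, h4, h5, hφ.1 j i l] at h
  simp only [coboundaryConst, Finset.sum_add_distrib, Finset.sum_sub_distrib]
  linear_combination h

/-- Every cocycle is, modulo a coboundary, of weight zero. -/
theorem IsCocycleConst.exists_sub_coboundaryConst_weight_zero {φ : Fin n → Fin n → Fin n → K}
    (hc : IsLieLaw c)
    (hφ : IsCocycleConst c φ) {t : Fin n} {w : Fin n → K} (ht : IsDiagonalAt c t w)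
    (hw : ∀ i j k, w k ≠ w i + w j → c i j k = 0) :
    ∃ f, ∀ i j k, w k ≠ w i + w j → (φ - coboundaryConst c f) i j k = 0 := by
  -- This inverts Cartan's formula: the contraction with `X_t` is divided by its weight. Whenever a
  -- structure constant in the coboundary is nonzero, the divisor is the nonzero weight `w k - w i -
  -- w j`. Divisions by zero therefore only meet vanishing structure constants.
  refine ⟨fun i k => φ t i k / (w k - w i), fun i j k hijk => ?_⟩
  have hne : w k - w i - w j ≠ 0 := fun h => hijk (by linear_combination h)
  have key (x y d : K) (hy : d ≠ w k - w i - w j → y = 0) :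
      x / d * y = x * y / (w k - w i - w j) := by
    by_cases hd : d = w k - w i - w j
    · rw [hd, div_mul_eq_mul_div]
    · simp [hy hd]
  have h := hφ.weight_mul hc ht i j k
  rw [Pi.sub_apply, Pi.sub_apply, Pi.sub_apply, sub_eq_zero, eq_comm,
    ← mul_right_inj' hne, h, coboundaryConst, coboundaryConst, Finset.mul_sum]
  refine Finset.sum_congr rfl fun m _ => ?_
  rw [key _ (c i m k) (w m - w j), key _ (c m j k) (w m - w i), mul_comm (c i j m),
    key _ (c i j m) (w k - w m)]
  · field_simp
  · exact fun hd => hw _ _ _ fun h' => hd (by linear_combination -h')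
  · exact fun hd => hw _ _ _ fun h' => hd (by linear_combination -h')
  · exact fun hd => hw _ _ _ fun h' => hd (by linear_combination -h')

/-- If the cocycles of weight zero are coboundaries, then so are all cocycles. -/
theorem LieLaw.cocyclesAreCoboundaries_of_weight_zero [CharZero K] (μ : LieLaw K n) {t : Fin n}
    {w : Fin n → K} (ht : IsDiagonalAt μ.1 t w) (hw : ∀ i j k, w k ≠ w i + w j → μ.1 i j k = 0)
    (h : ∀ φ, IsCocycleConst μ.1 φ → (∀ i j k, w k ≠ w i + w j → φ i j k = 0) →
      ∃ f, φ = coboundaryConst μ.1 f) : CocyclesAreCoboundaries μ.1 := by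
  intro φ hφ
  obtain ⟨f, hf⟩ := hφ.exists_sub_coboundaryConst_weight_zero μ.2 ht hw
  obtain ⟨g, hg⟩ := h _ (hφ.sub (μ.isCocycleConst_coboundaryConst f)) hf
  exact ⟨f + g, by rw [coboundaryConst_add, ← hg]; abel⟩

/-- The inner derivation of the vector `x`, as an array. -/
def innerConst (c : Fin n → Fin n → Fin n → K) (x : Fin n → K) (i k : Fin n) : K :=
  ∑ m, x m * c m i k

/-- Every derivation of the law `c` is inner. -/
def DerivationsAreInner (c : Fin n → Fin n → Fin n → K) : Prop :=
  ∀ f, coboundaryConst c f = 0 → ∃ x, f = innerConst c x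

theorem innerConst_add (c : Fin n → Fin n → Fin n → K) (x y : Fin n → K) :
    innerConst c (x + y) = innerConst c x + innerConst c y := by
  funext i k
  simp only [innerConst, Pi.add_apply, add_mul, Finset.sum_add_distrib]

theorem coboundaryConst_innerConst (hc : IsLieLaw c) (x : Fin n → K) :
    coboundaryConst c (innerConst c x) = 0 := by
  funext i j k
  have h (a : Fin n) : ∑ m, (c a j m * c i m k + c a i m * c m j k - c i j m * c a m k) = 0 := by
    rw [← neg_eq_zero, ← hc.2 a i j k, ← Finset.sum_neg_distrib]
    refine Finset.sum_congr rfl fun m _ => ?_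
    rw [hc.1 j a, hc.1 m j]
    ring
  simp only [coboundaryConst, innerConst, Finset.mul_sum, Finset.sum_mul, ← Finset.sum_add_distrib,
    ← Finset.sum_sub_distrib]
  rw [Finset.sum_comm]
  refine Finset.sum_eq_zero fun a _ => ?_
  rw [← mul_zero (x a), ← h a, Finset.mul_sum]
  exact Finset.sum_congr rfl fun m _ => by ring

/-- Applying the derivation to `[X_t, X_i] = w i X_i` gives `(w k - w i) f i k = -∑ m, f t m * c m i
k`. Only those `m` with `w m = w k - w i` contribute, so dividing the coordinates of `f t` by their
own weights gives the inner derivation to subtract. -/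
theorem exists_sub_innerConst_weight_zero {f : Fin n → Fin n → K}
    (hf : coboundaryConst c f = 0) {t : Fin n} {w : Fin n → K} (ht : IsDiagonalAt c t w)
    (hw : ∀ i j k, w k ≠ w i + w j → c i j k = 0) :
    ∃ x, ∀ i k, w k ≠ w i → (f - innerConst c x) i k = 0 := by
  refine ⟨fun m => -f t m / w m, fun i k hik => ?_⟩
  have h := congrFun (congrFun (congrFun hf t) i) k
  have h1 : ∑ m, f i m * c t m k = f i k * w k := by simp [fun m => ht m k]
  have h2 : ∑ m, c t i m * f m k = w i * f i k := by simp [ht i]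
  simp only [coboundaryConst, Finset.sum_add_distrib, Finset.sum_sub_distrib, Pi.zero_apply, h1,
    h2] at h
  have hne : w k - w i ≠ 0 := sub_ne_zero.2 hik
  have h3 : (w k - w i) * innerConst c (fun m => -f t m / w m) i k = -∑ m, f t m * c m i k := by
    rw [innerConst, Finset.mul_sum, ← Finset.sum_neg_distrib]
    refine Finset.sum_congr rfl fun m _ => ?_
    by_cases hm : w k = w m + w i
    · have : w m = w k - w i := by linear_combination -hm
      rw [this]
      field_simp
    · simp [hw _ _ _ hm]
  rw [Pi.sub_apply, Pi.sub_apply, sub_eq_zero, ← mul_right_inj' hne, h3]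
  linear_combination h

/-- If the derivations of weight zero are inner, then so are all derivations. -/
theorem derivationsAreInner_of_weight_zero (hc : IsLieLaw c) {t : Fin n}
    {w : Fin n → K} (ht : IsDiagonalAt c t w) (hw : ∀ i j k, w k ≠ w i + w j → c i j k = 0)
    (h : ∀ f, coboundaryConst c f = 0 → (∀ i k, w k ≠ w i → f i k = 0) →
      ∃ x, f = innerConst c x) : DerivationsAreInner c := by
  intro f hf
  obtain ⟨x, hx⟩ := exists_sub_innerConst_weight_zero hf ht hw
  obtain ⟨y, hy⟩ := h (f - innerConst c x)
    (by rw [coboundaryConst_sub, hf, coboundaryConst_innerConst hc, sub_zero]) hx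
  exact ⟨x + y, by rw [innerConst_add, ← hy]; abel⟩

theorem LieLaw.isCompleteLie [CharZero K] (μ : LieLaw K n) (hD : DerivationsAreInner μ.1)
    (hZ : ∀ x, innerConst μ.1 x = 0 → x = 0) : IsCompleteLie K μ.Alg := by
  refine ⟨(LieSubmodule.eq_bot_iff _).2 fun x hx => hZ x ?_, fun D => ?_⟩
  · funext i k
    have h := congrFun ((LieModule.mem_maxTrivSubmodule K μ.Alg μ.Alg x).1 hx (μ.basis i)) k
    rw [lie_basis_left] at h
    change ∑ m, x m * μ.1 m i k = 0
    rw [← neg_eq_zero, ← Finset.sum_neg_distrib]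
    refine Eq.trans (Finset.sum_congr rfl fun m _ => ?_) h
    rw [μ.2.1 m i k]
    ring
  · have hlie (x : μ.Alg) (i k : Fin n) : ⁅x, μ.basis i⁆ k = innerConst μ.1 x i k := by
      rw [lie_def, basis_apply]
      exact bilinOfConst_single_right _ _ _ _
    have hconstr : μ.endOfConst (fun i m => D (μ.basis i) m) = D.toLinearMap :=
      μ.basis.ext fun i => μ.endOfConst_basis _ i
    obtain ⟨x, hx⟩ := hD (fun i m => D (μ.basis i) m) <| by
      funext i j k
      refine (μ.d₁₂_endOfConst_basis _ i j k).symm.trans ?_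
      rw [hconstr, LieModule.Cohomology.d₁₂_apply_apply]
      exact congrFun (sub_eq_zero.2 (D.leibniz' (μ.basis i) (μ.basis j)).symm) k
    refine ⟨x, fun y => LinearMap.congr_fun (f := D.toLinearMap) (g := LieAlgebra.ad K μ.Alg x)
      (μ.basis.ext fun i => funext fun k => ?_) y⟩
    exact (congrFun (congrFun hx i) k).trans (hlie x i k).symm

end Weights

/-! ### Sparse linear relations for laws with integral structure constants -/

section Sparse

variable {K : Type*} [Field K] {n : ℕ}

/-- The value of a linear form, given by a list of coefficients and entries, at the array `x`. -/
def evalForm {ι : Type*} (x : ι → K) (L : List (ℤ × ι)) : K :=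
  (L.map fun p => (p.1 : K) * x p.2).sum

theorem evalForm_nil {ι : Type*} (x : ι → K) : evalForm x [] = 0 := rfl

theorem evalForm_cons {ι : Type*} (x : ι → K) (p : ℤ × ι) (L : List (ℤ × ι)) :
    evalForm x (p :: L) = p.1 * x p.2 + evalForm x L := List.sum_cons

theorem evalForm_append {ι : Type*} (x : ι → K) (L M : List (ℤ × ι)) :
    evalForm x (L ++ M) = evalForm x L + evalForm x M := by
  simp [evalForm]

theorem evalForm_filter {ι : Type*} (x : ι → K) (L : List (ℤ × ι)) :
    evalForm x (L.filter fun p => p.1 ≠ 0) = evalForm x L := by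
  induction L with
  | nil => rfl
  | cons p L ih =>
    rw [List.filter_cons, evalForm_cons, ← ih]
    by_cases h : p.1 = 0 <;> simp [h, evalForm_cons]

theorem evalForm_flatMap {ι α : Type*} (x : ι → K) (l : List α) (L : α → List (ℤ × ι)) :
    evalForm x (l.flatMap L) = (l.map fun a => evalForm x (L a)).sum := by
  induction l with
  | nil => rfl
  | cons a l ih => simp [evalForm_append, ih]

/-- The entries of a skew-symmetric array, rewritten with increasing indices. -/
def skewNormalize (L : List (ℤ × Fin n × Fin n × Fin n)) : List (ℤ × Fin n × Fin n × Fin n) :=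
  L.flatMap fun p => if p.2.1 < p.2.2.1 then [p] else
    if p.2.2.1 < p.2.1 then [(-p.1, p.2.2.1, p.2.1, p.2.2.2)] else []

theorem evalForm_skewNormalize [CharZero K] {φ : Fin n → Fin n → Fin n → K}
    (hφ : ∀ i j k, φ i j k = -φ j i k) (L : List (ℤ × Fin n × Fin n × Fin n)) :
    evalForm (fun p => φ p.1 p.2.1 p.2.2) (skewNormalize L) =
      evalForm (fun p => φ p.1 p.2.1 p.2.2) L := by
  induction L with
  | nil => rfl
  | cons p L ih =>
    obtain ⟨a, i, j, k⟩ := p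
    rw [skewNormalize, List.flatMap_cons, evalForm_append, ← skewNormalize, ih, evalForm_cons]
    congr 1
    rcases lt_trichotomy i j with h | rfl | h
    · simp [h, evalForm_cons, evalForm_nil]
    · simp [evalForm_nil, self_eq_neg.1 (hφ i i k)]
    · simp [h, h.not_gt, evalForm_cons, evalForm_nil, hφ i j k]

/-- The cocycle relation at `(i, j, k)`, coordinate `l`, as a linear form. -/
def cocycleForm (c : Fin n → Fin n → Fin n → ℤ) (i j k l : Fin n) :
    List (ℤ × Fin n × Fin n × Fin n) :=
  skewNormalize <| ((List.finRange n).flatMap fun m =>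
    [(c j k m, i, m, l), (c i m l, j, k, m), (c k i m, j, m, l), (c j m l, k, i, m),
      (c i j m, k, m, l), (c k m l, i, j, m)]).filter fun p => p.1 ≠ 0

theorem IsCocycleConst.evalForm_cocycleForm [CharZero K] {c : Fin n → Fin n → Fin n → ℤ}
    {φ : Fin n → Fin n → Fin n → K} (hφ : IsCocycleConst (fun i j k => (c i j k : K)) φ)
    (i j k l : Fin n) :
    evalForm (fun p => φ p.1 p.2.1 p.2.2) (cocycleForm c i j k l) = 0 := by
  rw [cocycleForm, evalForm_skewNormalize hφ.1, evalForm_filter, evalForm_flatMap,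
    ← Fin.sum_univ_def, ← hφ.2 i j k l]
  refine Finset.sum_congr rfl fun m _ => ?_
  simp only [evalForm_cons, evalForm_nil]
  ring

/-- The coordinate `k` at `(i, j)` of the coboundary, as a linear form. -/
def coboundaryForm (c : Fin n → Fin n → Fin n → ℤ) (i j k : Fin n) : List (ℤ × Fin n × Fin n) :=
  ((List.finRange n).flatMap fun m =>
    [(c i m k, j, m), (c m j k, i, m), (-c i j m, m, k)]).filter fun p => p.1 ≠ 0

theorem evalForm_coboundaryForm (c : Fin n → Fin n → Fin n → ℤ) (f : Fin n → Fin n → K)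
    (i j k : Fin n) : evalForm (fun p => f p.1 p.2) (coboundaryForm c i j k) =
      coboundaryConst (fun i j k => (c i j k : K)) f i j k := by
  rw [coboundaryForm, evalForm_filter, evalForm_flatMap, ← Fin.sum_univ_def]
  refine Finset.sum_congr rfl fun m _ => ?_
  simp only [evalForm_cons, evalForm_nil]
  push_cast
  ring

/-- For a concrete table the hypothesis is a closed computation over `ℤ`, which the kernel can
decide; the conclusion is a short relation over `K` with only the nonzero coefficients. -/
theorem coboundaryConst_eq_evalForm {c : Fin n → Fin n → Fin n → ℤ} (f : Fin n → Fin n → K)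
    {i j k : Fin n} {L : List (ℤ × Fin n × Fin n)} (hL : coboundaryForm c i j k = L) :
    coboundaryConst (fun i j k => (c i j k : K)) f i j k = evalForm (fun p => f p.1 p.2) L := by
  rw [← hL, evalForm_coboundaryForm]

theorem IsCocycleConst.evalForm_eq_zero [CharZero K] {c : Fin n → Fin n → Fin n → ℤ}
    {φ : Fin n → Fin n → Fin n → K} (hφ : IsCocycleConst (fun i j k => (c i j k : K)) φ)
    {i j k l : Fin n} {L : List (ℤ × Fin n × Fin n × Fin n)} (hL : cocycleForm c i j k l = L) :
    evalForm (fun p => φ p.1 p.2.1 p.2.2) L = 0 :=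
  hL ▸ hφ.evalForm_cocycleForm i j k l

/-- The coordinate `k` of the bracket of a vector with the basis vector `i`, as a linear form. -/
def innerForm (c : Fin n → Fin n → Fin n → ℤ) (i k : Fin n) : List (ℤ × Fin n) :=
  ((List.finRange n).map fun m => (c m i k, m)).filter fun p => p.1 ≠ 0

theorem innerConst_eq_evalForm {c : Fin n → Fin n → Fin n → ℤ} (x : Fin n → K) {i k : Fin n}
    {L : List (ℤ × Fin n)} (hL : innerForm c i k = L) :
    innerConst (fun i j k => (c i j k : K)) x i k = evalForm x L := by
  rw [← hL, innerForm, evalForm_filter, evalForm, List.map_map, ← Fin.sum_univ_def]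
  exact Finset.sum_congr rfl fun m _ => mul_comm _ _

theorem coboundaryConst_weight_zero {c : Fin n → Fin n → Fin n → K}
    {w : Fin n → ℤ} (hw : ∀ i j k, w k ≠ w i + w j → c i j k = 0) {f : Fin n → Fin n → K}
    (hf : ∀ i k, w k ≠ w i → f i k = 0) (i j k : Fin n) (hijk : w k ≠ w i + w j) :
    coboundaryConst c f i j k = 0 := by
  refine Finset.sum_eq_zero fun m _ => ?_
  have h1 : f j m * c i m k = 0 := by
    by_cases h : w m = w j
    · rw [hw i m k (by rwa [h]), mul_zero]
    · rw [hf j m h, zero_mul]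
  have h2 : f i m * c m j k = 0 := by
    by_cases h : w m = w i
    · rw [hw m j k (by rwa [h]), mul_zero]
    · rw [hf i m h, zero_mul]
  have h3 : c i j m * f m k = 0 := by
    by_cases h : w m = w i + w j
    · rw [hf m k (by rwa [h]), mul_zero]
    · rw [hw i j m h, zero_mul]
  rw [h1, h2, h3, add_zero, sub_zero]

variable [CharZero K] {t : ℕ → ℕ → ℕ → ℤ} {h : IsLieLaw (structConst n t)} {s : Fin n}
  {w : Fin n → ℤ}

theorem isDiagonalAt_lawOfTable
    (hs : ∀ i k, structConst n t s i k = if i = k then w i else 0) :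
    IsDiagonalAt (lawOfTable K t h).1 s fun i => (w i : K) := fun i k => by
  change ((structConst n t s i k : ℤ) : K) = _
  rw [hs]
  split_ifs <;> simp

/-- For a table with integral weights, all cocycles are coboundaries as soon as the cocycles of
weight zero can be normalized by a coboundary of weight zero so that they vanish. -/
theorem cocyclesAreCoboundaries_lawOfTable
    (hs : ∀ i k, structConst n t s i k = if i = k then w i else 0)
    (hw : ∀ i j k, w k ≠ w i + w j → structConst n t i j k = 0)
    (F : (Fin n → Fin n → Fin n → K) → Fin n → Fin n → K)
    (hF : ∀ φ ψ : Fin n → Fin n → Fin n → K, IsCocycleConst (lawOfTable K t h).1 ψ →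
      (ψ = φ - coboundaryConst (lawOfTable K t h).1 fun i k => if w k = w i then F φ i k else 0) →
      ∀ i j k, i < j → w k = w i + w j → ψ i j k = 0) :
    CocyclesAreCoboundaries (lawOfTable K t h).1 := by
  have hw' (i j k : Fin n) (hijk : w k ≠ w i + w j) : (lawOfTable K t h).1 i j k = 0 := by
    change ((structConst n t i j k : ℤ) : K) = 0
    rw [hw i j k hijk, Int.cast_zero]
  refine (lawOfTable K t h).cocyclesAreCoboundaries_of_weight_zero (isDiagonalAt_lawOfTable hs)
    (fun i j k hijk => hw' i j k (by exact_mod_cast hijk)) fun φ hφ hφw => ?_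
  -- Truncating `F φ` to weight zero keeps its coboundary in weight zero, so the entries of `φ` that
  -- already vanish are not disturbed.
  refine ⟨fun i k => if w k = w i then F φ i k else 0, sub_eq_zero.1 ?_⟩
  have hψ := hφ.sub ((lawOfTable K t h).isCocycleConst_coboundaryConst
    fun i k => if w k = w i then F φ i k else 0)
  have hlt (i j k : Fin n) (hij : i < j) : (φ - coboundaryConst (lawOfTable K t h).1
      fun i k => if w k = w i then F φ i k else 0) i j k = 0 := by
    by_cases hijk : w k = w i + w j
    · exact hF φ _ hψ rfl i j k hij hijk
    · rw [Pi.sub_apply, Pi.sub_apply, Pi.sub_apply, hφw i j k (by exact_mod_cast hijk),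
        coboundaryConst_weight_zero hw' (fun i k hik => if_neg hik) i j k hijk, sub_zero]
  funext i j k
  rcases lt_trichotomy i j with hij | rfl | hij
  · exact hlt i j k hij
  · exact self_eq_neg.1 (hψ.1 i i k)
  · rw [hψ.1 i j k, hlt j i k hij]
    exact neg_zero

/-- For a table with integral weights, all derivations are inner as soon as the derivations of
weight zero can be normalized by an inner derivation of weight zero so that they vanish. -/
theorem derivationsAreInner_lawOfTable
    (hs : ∀ i k, structConst n t s i k = if i = k then w i else 0)
    (hw : ∀ i j k, w k ≠ w i + w j → structConst n t i j k = 0)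
    (X : (Fin n → Fin n → K) → Fin n → K)
    (hX : ∀ f g : Fin n → Fin n → K, coboundaryConst (lawOfTable K t h).1 g = 0 →
      (g = f - innerConst (lawOfTable K t h).1 fun i => if w i = 0 then X f i else 0) →
      ∀ i k, w k = w i → g i k = 0) :
    DerivationsAreInner (lawOfTable K t h).1 := by
  have hw' (i j k : Fin n) (hijk : w k ≠ w i + w j) : (lawOfTable K t h).1 i j k = 0 := by
    change ((structConst n t i j k : ℤ) : K) = 0
    rw [hw i j k hijk, Int.cast_zero]
  refine derivationsAreInner_of_weight_zero (lawOfTable K t h).2 (isDiagonalAt_lawOfTable hs)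
    (fun i j k hijk => hw' i j k (by exact_mod_cast hijk)) fun f hf hfw => ?_
  refine ⟨fun i => if w i = 0 then X f i else 0, sub_eq_zero.1 ?_⟩
  funext i k
  by_cases hik : w k = w i
  · refine hX f _ ?_ rfl i k hik
    rw [coboundaryConst_sub, hf, coboundaryConst_innerConst (lawOfTable K t h).2, sub_zero]
  · rw [Pi.sub_apply, Pi.sub_apply, hfw i k (by exact_mod_cast hik), innerConst,
      Finset.sum_eq_zero, sub_zero]
    · rfl
    · intro m _
      by_cases hm : w m = 0
      · rw [hw' m i k (by rwa [hm, zero_add]), mul_zero]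
      · rw [if_neg hm, zero_mul]

end Sparse

/-! ### Cohomology of the two eight-dimensional laws -/

section EightDimensional

/-- Endomorphisms of weight zero have dimension 4+1+4+1+4 = 14, and the derivations among them are
spanned by `ad X₇` and `ad X₈`. The coboundaries of weight zero thus have dimension 12. The matrix
below is chosen to kill 12 of the 31 entries; its first row can be zero because of the two inner
derivations. The cocycle relations eliminate the other 19. -/
theorem cocyclesAreCoboundaries_G1 (K : Type*) [Field K] [CharZero K] :
    CocyclesAreCoboundaries (lawOfTable K tableG1 isLieLaw_G1).1 := by
  refine cocyclesAreCoboundaries_lawOfTable (s := 6) (w := ![1, 1, 2, 3, 4, 3, 0, 0])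
    (by decide +kernel) (by decide +kernel)
    (fun φ => ![0,
      ![φ 0 7 0 - 1/2 * φ 2 7 2, 1/2 * φ 0 7 1 + 1/2 * φ 1 7 0, 0, 0, 0, 0, 0, 0],
      ![0, 0, -φ 0 1 2 + 1/2 * φ 0 7 1 + 1/2 * φ 1 7 0, 0, 0, 0, 0, 0],
      ![0, 0, 0, -φ 0 2 3 - φ 0 1 2 + 1/2 * φ 0 7 1 + 1/2 * φ 1 7 0, 0, -φ 0 2 5, 0, 0],
      ![0, 0, 0, 0, -φ 0 3 4 - φ 0 2 3 - φ 0 1 2 + 1/2 * φ 0 7 1 + 1/2 * φ 1 7 0, 0, 0, 0],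
      ![0, 0, 0, φ 0 5 4, 0, φ 1 2 5 + φ 0 7 1 + φ 1 7 0 - φ 0 1 2, 0, 0],
      ![0, 0, 0, 0, 0, 0, -φ 0 6 0, -φ 0 6 1],
      ![0, 0, 0, 0, 0, 0, -1/2 * φ 2 7 2, 1/2 * φ 1 7 0 - 1/2 * φ 0 7 1]]) fun φ ψ hψ hψφ i j k hij
          hijk => ?_
  have hd {i j k : Fin 8} {L : List (ℤ × Fin 8 × Fin 8)}
      (hL : coboundaryForm (structConst 8 tableG1) i j k = L) :=
    (congrFun (congrFun (congrFun hψφ i) j) k).trans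
      (congrArg (φ i j k - ·) (coboundaryConst_eq_evalForm _ hL))
  have hmem : (i, j, k) ∈ [(0, 1, 2), (0, 2, 3), (0, 2, 5), (0, 3, 4), (0, 5, 4), (0, 6, 0), (0, 6,
      1), (0, 7, 0), (0, 7, 1), (1, 2, 3), (1, 2, 5), (1, 3, 4), (1, 5, 4), (1, 6, 0), (1, 6, 1),
      (1, 7, 0), (1, 7, 1), (2, 6, 2), (2, 7, 2), (3, 6, 3), (3, 6, 5), (3, 7, 3), (3, 7, 5), (4,
      6, 4), (4, 7, 4), (5, 6, 3), (5, 6, 5), (5, 7, 3), (5, 7, 5), (6, 7, 6), (6, 7, 7)] := by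
    revert i j k
    decide +kernel
  -- The facts named `g` are the normalizations: each entry vanishes by the choice of the subtracted
  -- coboundary, without using the cocycle relations.
  have g060 : ψ 0 6 0 = 0 := by
    rw [hd (show _ = [(-1, 0, 0), (1, 0, 0), (-1, 6, 6)] by decide +kernel)]
    simp [evalForm_cons, evalForm_nil]
  have g061 : ψ 0 6 1 = 0 := by
    rw [hd (show _ = [(1, 0, 1), (-1, 0, 1), (-1, 6, 7)] by decide +kernel)]
    simp [evalForm_cons, evalForm_nil]
  have g272 : ψ 2 7 2 = 0 := by
    rw [hd (show _ = [(-2, 7, 6)] by decide +kernel)]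
    simp [evalForm_cons, evalForm_nil]
    ring
  have g070 : ψ 0 7 0 = 0 := by
    rw [hd (show _ = [(1, 0, 1), (1, 1, 0), (-1, 7, 6)] by decide +kernel)]
    simp [evalForm_cons, evalForm_nil]
    ring
  have g071 : ψ 0 7 1 = 0 := by
    rw [hd (show _ = [(-1, 0, 0), (1, 1, 1), (-1, 7, 7)] by decide +kernel)]
    simp [evalForm_cons, evalForm_nil]
    ring
  have g170 : ψ 1 7 0 = 0 := by
    rw [hd (show _ = [(-1, 0, 0), (1, 1, 1), (1, 7, 7)] by decide +kernel)]
    simp [evalForm_cons, evalForm_nil]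
    ring
  have g012 : ψ 0 1 2 = 0 := by
    rw [hd (show _ = [(1, 0, 0), (1, 1, 1), (-1, 2, 2)] by decide +kernel)]
    simp [evalForm_cons, evalForm_nil]
  have g023 : ψ 0 2 3 = 0 := by
    rw [hd (show _ = [(1, 0, 0), (1, 2, 2), (-1, 3, 3)] by decide +kernel)]
    simp [evalForm_cons, evalForm_nil]
  have g034 : ψ 0 3 4 = 0 := by
    rw [hd (show _ = [(1, 0, 0), (1, 3, 3), (-1, 4, 4)] by decide +kernel)]
    simp [evalForm_cons, evalForm_nil]
    ring
  have g025 : ψ 0 2 5 = 0 := by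
    rw [hd (show _ = [(-1, 0, 1), (-1, 3, 5)] by decide +kernel)]
    simp [evalForm_cons, evalForm_nil]
  have g054 : ψ 0 5 4 = 0 := by
    rw [hd (show _ = [(-1, 0, 1), (1, 5, 3)] by decide +kernel)]
    simp [evalForm_cons, evalForm_nil]
  have g125 : ψ 1 2 5 = 0 := by
    rw [hd (show _ = [(-1, 1, 1), (-1, 2, 2), (1, 5, 5)] by decide +kernel)]
    simp [evalForm_cons, evalForm_nil]
    ring
  -- The digits of each name are the indices `i j k l` of the cocycle relation.
  have e0124 := hψ.evalForm_eq_zero (show cocycleForm (structConst 8 tableG1) 0 1 2 4 =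
    [(1, 1, 2, 3), (-1, 1, 3, 4), (-1, 0, 5, 4), (1, 0, 2, 5)] by decide +kernel)
  have e0162 := hψ.evalForm_eq_zero (show cocycleForm (structConst 8 tableG1) 0 1 6 2 =
    [(-1, 0, 1, 2), (1, 0, 6, 0), (-1, 0, 1, 2), (1, 1, 6, 1), (-1, 2, 6, 2), (2, 0, 1, 2)]
        by decide +kernel)
  have e0172 := hψ.evalForm_eq_zero (show cocycleForm (structConst 8 tableG1) 0 1 7 2 =
    [(1, 0, 7, 0), (1, 1, 7, 1), (-1, 2, 7, 2)] by decide +kernel)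
  have e0263 := hψ.evalForm_eq_zero (show cocycleForm (structConst 8 tableG1) 0 2 6 3 =
    [(-1, 0, 2, 3), (1, 0, 6, 0), (-2, 0, 2, 3), (1, 2, 6, 2), (-1, 3, 6, 3), (3, 0, 2, 3)]
        by decide +kernel)
  have e0265 := hψ.evalForm_eq_zero (show cocycleForm (structConst 8 tableG1) 0 2 6 5 =
    [(-1, 0, 2, 5), (-1, 0, 6, 1), (-2, 0, 2, 5), (-1, 3, 6, 5), (3, 0, 2, 5)] by decide +kernel)
  have e0273 := hψ.evalForm_eq_zero (show cocycleForm (structConst 8 tableG1) 0 2 7 3 =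
    [(1, 0, 7, 0), (-1, 1, 2, 3), (1, 2, 7, 2), (-1, 3, 7, 3), (1, 0, 2, 5)] by decide +kernel)
  have e0275 := hψ.evalForm_eq_zero (show cocycleForm (structConst 8 tableG1) 0 2 7 5 =
    [(-1, 1, 2, 5), (-1, 0, 7, 1), (-1, 3, 7, 5), (-1, 0, 2, 3)] by decide +kernel)
  have e0364 := hψ.evalForm_eq_zero (show cocycleForm (structConst 8 tableG1) 0 3 6 4 =
    [(-1, 0, 3, 4), (1, 0, 6, 0), (-3, 0, 3, 4), (1, 3, 6, 3), (-1, 4, 6, 4), (4, 0, 3, 4)]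
        by decide +kernel)
  have e0374 := hψ.evalForm_eq_zero (show cocycleForm (structConst 8 tableG1) 0 3 7 4 =
    [(1, 0, 7, 0), (-1, 1, 3, 4), (1, 3, 7, 3), (-1, 4, 7, 4), (1, 0, 5, 4)] by decide +kernel)
  have e0564 := hψ.evalForm_eq_zero (show cocycleForm (structConst 8 tableG1) 0 5 6 4 =
    [(-1, 0, 5, 4), (-1, 0, 6, 1), (1, 5, 6, 3), (4, 0, 5, 4), (-3, 0, 5, 4)] by decide +kernel)
  have e0574 := hψ.evalForm_eq_zero (show cocycleForm (structConst 8 tableG1) 0 5 7 4 =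
    [(-1, 1, 5, 4), (-1, 0, 7, 1), (-1, 0, 3, 4), (1, 5, 7, 3)] by decide +kernel)
  have e0670 := hψ.evalForm_eq_zero (show cocycleForm (structConst 8 tableG1) 0 6 7 0 =
    [(-1, 0, 7, 0), (1, 0, 7, 0), (-1, 1, 6, 0), (-1, 0, 6, 1), (-1, 6, 7, 6)] by decide +kernel)
  have e0671 := hψ.evalForm_eq_zero (show cocycleForm (structConst 8 tableG1) 0 6 7 1 =
    [(1, 0, 7, 1), (1, 0, 6, 0), (-1, 1, 6, 1), (-1, 0, 7, 1), (-1, 6, 7, 7)] by decide +kernel)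
  have e1263 := hψ.evalForm_eq_zero (show cocycleForm (structConst 8 tableG1) 1 2 6 3 =
    [(1, 1, 6, 0), (-1, 1, 2, 3), (-2, 1, 2, 3), (3, 1, 2, 3), (1, 5, 6, 3)] by decide +kernel)
  have e1265 := hψ.evalForm_eq_zero (show cocycleForm (structConst 8 tableG1) 1 2 6 5 =
    [(-1, 1, 2, 5), (-1, 1, 6, 1), (-2, 1, 2, 5), (-1, 2, 6, 2), (1, 5, 6, 5), (3, 1, 2, 5)]
        by decide +kernel)
  have e1273 := hψ.evalForm_eq_zero (show cocycleForm (structConst 8 tableG1) 1 2 7 3 =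
    [(1, 0, 2, 3), (1, 1, 7, 0), (1, 5, 7, 3), (1, 1, 2, 5)] by decide +kernel)
  have e1275 := hψ.evalForm_eq_zero (show cocycleForm (structConst 8 tableG1) 1 2 7 5 =
    [(1, 0, 2, 5), (-1, 1, 7, 1), (-1, 2, 7, 2), (-1, 1, 2, 3), (1, 5, 7, 5)] by decide +kernel)
  have e1564 := hψ.evalForm_eq_zero (show cocycleForm (structConst 8 tableG1) 1 5 6 4 =
    [(-1, 1, 5, 4), (-1, 1, 6, 1), (1, 4, 6, 4), (4, 1, 5, 4), (-3, 1, 5, 4), (-1, 5, 6, 5)]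
        by decide +kernel)
  have e1574 := hψ.evalForm_eq_zero (show cocycleForm (structConst 8 tableG1) 1 5 7 4 =
    [(1, 0, 5, 4), (-1, 1, 7, 1), (-1, 1, 3, 4), (1, 4, 7, 4), (-1, 5, 7, 5)] by decide +kernel)
  simp only [evalForm_cons, evalForm_nil, g060, g061, g272, g070, g071, g170, g012, g023, g034,
      g025, g054, g125]
    at e0124 e0162 e0172 e0263 e0265 e0273 e0275 e0364 e0374 e0564
  simp only [evalForm_cons, evalForm_nil, g060, g061, g272, g070, g071, g170, g012, g023, g034,
      g025, g054, g125]
    at e0574 e0670 e0671 e1263 e1265 e1273 e1275 e1564 e1574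
  -- The coefficients solve the linear system left for the 19 entries that were not normalized.
  have z123 : ψ 1 2 3 = 0 := by linear_combination 1/2 * e0124 - 1/4 * e0374 - 1/4 * e0273 - 1/4 *
      e1574 - 1/2 * e0172 - 1/4 * e1275
  have z134 : ψ 1 3 4 = 0 := by linear_combination -1/4 * e0374 - 1/4 * e0273 - 1/2 * e0124 - 1/4 *
      e1574 - 1/2 * e0172 - 1/4 * e1275
  have z154 : ψ 1 5 4 = 0 := by linear_combination e1273 - e0574
  have z160 : ψ 1 6 0 = 0 := by linear_combination e1263 - e0564
  have z161 : ψ 1 6 1 = 0 := by linear_combination -1/2 * e0263 - 1/2 * e0364 - 1/2 * e1564 - 1/2 *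
      e1265
  have z171 : ψ 1 7 1 = 0 := by linear_combination e0172
  have z262 : ψ 2 6 2 = 0 := by linear_combination -1/2 * e0263 - 1/2 * e0364 - 1/2 * e1564 - e0162
      - 1/2 * e1265
  have z363 : ψ 3 6 3 = 0 := by linear_combination -1/2 * e0364 - 1/2 * e1564 - e0162 - 3/2 * e0263
      - 1/2 * e1265
  have z365 : ψ 3 6 5 = 0 := by linear_combination -e0265
  have z373 : ψ 3 7 3 = 0 := by linear_combination -3/4 * e0273 - 1/2 * e0124 + 1/4 * e0374 + 1/4 *
      e1574 + 1/2 * e0172 + 1/4 * e1275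
  have z375 : ψ 3 7 5 = 0 := by linear_combination -e0275
  have z464 : ψ 4 6 4 = 0 := by linear_combination -1/2 * e1564 - e0162 - 3/2 * e0263 - 3/2 * e0364
      - 1/2 * e1265
  have z474 : ψ 4 7 4 = 0 := by linear_combination 1/2 * e1574 + e0172 - 1/2 * e0374 - 1/2 * e0273
      + 1/2 * e1275
  have z563 : ψ 5 6 3 = 0 := by linear_combination e0564
  have z565 : ψ 5 6 5 = 0 := by linear_combination -e0162 - e0263 - e0364 - e1564
  have z573 : ψ 5 7 3 = 0 := by linear_combination e1273
  have z575 : ψ 5 7 5 = 0 := by linear_combination 3/4 * e1275 + 1/2 * e0124 + 1/2 * e0172 - 1/4 *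
      e0374 - 1/4 * e0273 - 1/4 * e1574
  have z676 : ψ 6 7 6 = 0 := by linear_combination -e0670 - e1263 + e0564
  have z677 : ψ 6 7 7 = 0 := by linear_combination -e0671 + 1/2 * e0263 + 1/2 * e0364 + 1/2 * e1564
      + 1/2 * e1265
  simp only [List.mem_cons, Prod.mk.injEq, List.not_mem_nil, or_false] at hmem
  rcases hmem with ⟨rfl, rfl, rfl⟩ | ⟨rfl, rfl, rfl⟩ | ⟨rfl, rfl, rfl⟩ | ⟨rfl, rfl, rfl⟩ | ⟨rfl,
      rfl, rfl⟩ | ⟨rfl, rfl, rfl⟩ | ⟨rfl, rfl, rfl⟩ | ⟨rfl, rfl, rfl⟩ | ⟨rfl, rfl, rfl⟩ | ⟨rfl,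
      rfl, rfl⟩ | ⟨rfl, rfl, rfl⟩ | ⟨rfl, rfl, rfl⟩ | ⟨rfl, rfl, rfl⟩ | ⟨rfl, rfl, rfl⟩ | ⟨rfl,
      rfl, rfl⟩ | ⟨rfl, rfl, rfl⟩ | ⟨rfl, rfl, rfl⟩ | ⟨rfl, rfl, rfl⟩ | ⟨rfl, rfl, rfl⟩ | ⟨rfl,
      rfl, rfl⟩ | ⟨rfl, rfl, rfl⟩ | ⟨rfl, rfl, rfl⟩ | ⟨rfl, rfl, rfl⟩ | ⟨rfl, rfl, rfl⟩ | ⟨rfl,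
      rfl, rfl⟩ | ⟨rfl, rfl, rfl⟩ | ⟨rfl, rfl, rfl⟩ | ⟨rfl, rfl, rfl⟩ | ⟨rfl, rfl, rfl⟩ | ⟨rfl,
      rfl, rfl⟩ | ⟨rfl, rfl, rfl⟩ <;> assumption

theorem derivationsAreInner_G1 (K : Type*) [Field K] [CharZero K] :
    DerivationsAreInner (lawOfTable K tableG1 isLieLaw_G1).1 := by
  -- Since `ad X₇` and `ad X₈` send `X₁` to `X₁` and `X₂`, the two coordinates of `f` at `X₁`
  -- determine the inner derivation to subtract.
  refine derivationsAreInner_lawOfTable (s := 6) (w := ![1, 1, 2, 3, 4, 3, 0, 0])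
    (by decide +kernel) (by decide +kernel) (fun f => ![0, 0, 0, 0, 0, 0, f 0 0, f 0 1]) fun f g hg
        hgf i k hik => ?_
  have hd {i k : Fin 8} {L : List (ℤ × Fin 8)} (hL : innerForm (structConst 8 tableG1) i k = L) :=
    (congrFun (congrFun hgf i) k).trans (congrArg (f i k - ·) (innerConst_eq_evalForm _ hL))
  have he {i j k : Fin 8} {L : List (ℤ × Fin 8 × Fin 8)}
      (hL : coboundaryForm (structConst 8 tableG1) i j k = L) :=
    (coboundaryConst_eq_evalForm g hL).symm.trans (congrFun (congrFun (congrFun hg i) j) k)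
  have hmem : (i, k) ∈ [(0, 0), (0, 1), (1, 0), (1, 1), (2, 2), (3, 3), (3, 5), (4, 4), (5, 3), (5,
      5), (6, 6), (6, 7), (7, 6), (7, 7)] := by
    revert i k
    decide +kernel
  have z00 : g 0 0 = 0 := by
    rw [hd (show _ = [(1, 6)] by decide +kernel)]
    simp [evalForm_cons, evalForm_nil]
  have z01 : g 0 1 = 0 := by
    rw [hd (show _ = [(1, 7)] by decide +kernel)]
    simp [evalForm_cons, evalForm_nil]
  have e012 := he (show coboundaryForm _ 0 1 2 = [(1, 0, 0), (1, 1, 1), (-1, 2, 2)]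
      by decide +kernel)
  have e023 := he (show coboundaryForm _ 0 2 3 = [(1, 0, 0), (1, 2, 2), (-1, 3, 3)]
      by decide +kernel)
  have e025 := he (show coboundaryForm _ 0 2 5 = [(-1, 0, 1), (-1, 3, 5)] by decide +kernel)
  have e034 := he (show coboundaryForm _ 0 3 4 = [(1, 0, 0), (1, 3, 3), (-1, 4, 4)]
      by decide +kernel)
  have e054 := he (show coboundaryForm _ 0 5 4 = [(-1, 0, 1), (1, 5, 3)] by decide +kernel)
  have e060 := he (show coboundaryForm _ 0 6 0 = [(-1, 0, 0), (1, 0, 0), (-1, 6, 6)]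
      by decide +kernel)
  have e061 := he (show coboundaryForm _ 0 6 1 = [(1, 0, 1), (-1, 0, 1), (-1, 6, 7)]
      by decide +kernel)
  have e070 := he (show coboundaryForm _ 0 7 0 = [(1, 0, 1), (1, 1, 0), (-1, 7, 6)]
      by decide +kernel)
  have e071 := he (show coboundaryForm _ 0 7 1 = [(-1, 0, 0), (1, 1, 1), (-1, 7, 7)]
      by decide +kernel)
  have e123 := he (show coboundaryForm _ 1 2 3 = [(1, 1, 0), (1, 5, 3)] by decide +kernel)
  have e125 := he (show coboundaryForm _ 1 2 5 = [(-1, 1, 1), (-1, 2, 2), (1, 5, 5)]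
      by decide +kernel)
  have e154 := he (show coboundaryForm _ 1 5 4 = [(-1, 1, 1), (1, 4, 4), (-1, 5, 5)]
      by decide +kernel)
  simp only [evalForm_cons, evalForm_nil, Pi.zero_apply, z00, z01]
    at e012 e023 e025 e034 e054 e060 e061 e070 e071 e123 e125 e154
  have z10 : g 1 0 = 0 := by linear_combination e123 - e054
  have z11 : g 1 1 = 0 := by linear_combination -1/2 * e023 - 1/2 * e034 - 1/2 * e154 - 1/2 * e125
  have z22 : g 2 2 = 0 := by linear_combination -1/2 * e023 - 1/2 * e034 - 1/2 * e154 - e012 - 1/2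
      * e125
  have z33 : g 3 3 = 0 := by linear_combination -1/2 * e034 - 1/2 * e154 - e012 - 3/2 * e023 - 1/2
      * e125
  have z35 : g 3 5 = 0 := by linear_combination -e025
  have z44 : g 4 4 = 0 := by linear_combination -1/2 * e154 - e012 - 3/2 * e023 - 3/2 * e034 - 1/2
      * e125
  have z53 : g 5 3 = 0 := by linear_combination e054
  have z55 : g 5 5 = 0 := by linear_combination -e012 - e023 - e034 - e154
  have z66 : g 6 6 = 0 := by linear_combination -e060
  have z67 : g 6 7 = 0 := by linear_combination -e061
  have z76 : g 7 6 = 0 := by linear_combination e123 - e054 - e070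
  have z77 : g 7 7 = 0 := by linear_combination -e071 - 1/2 * e023 - 1/2 * e034 - 1/2 * e154 - 1/2
      * e125
  simp only [List.mem_cons, Prod.mk.injEq, List.not_mem_nil, or_false] at hmem
  rcases hmem with ⟨rfl, rfl⟩ | ⟨rfl, rfl⟩ | ⟨rfl, rfl⟩ | ⟨rfl, rfl⟩ | ⟨rfl, rfl⟩ | ⟨rfl, rfl⟩ |
      ⟨rfl, rfl⟩ | ⟨rfl, rfl⟩ | ⟨rfl, rfl⟩ | ⟨rfl, rfl⟩ | ⟨rfl, rfl⟩ | ⟨rfl, rfl⟩ | ⟨rfl, rfl⟩ |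
      ⟨rfl, rfl⟩ <;> assumption

/-- Bracketing with `X₇` kills the first six coordinates, as their weights are nonzero; bracketing
with `X₁` then reads off the last two. -/
theorem eq_zero_of_innerConst_G1 (K : Type*) [Field K] [CharZero K] (x : Fin 8 → K)
    (hx : innerConst (lawOfTable K tableG1 isLieLaw_G1).1 x = 0) : x = 0 := by
  have hd {i k : Fin 8} {L : List (ℤ × Fin 8)} (hL : innerForm (structConst 8 tableG1) i k = L) :=
    (innerConst_eq_evalForm x hL).symm.trans (congrFun (congrFun hx i) k)
  have e60 := hd (show innerForm _ 6 0 = [(-1, 0)] by decide +kernel)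
  have e61 := hd (show innerForm _ 6 1 = [(-1, 1)] by decide +kernel)
  have e62 := hd (show innerForm _ 6 2 = [(-2, 2)] by decide +kernel)
  have e63 := hd (show innerForm _ 6 3 = [(-3, 3)] by decide +kernel)
  have e64 := hd (show innerForm _ 6 4 = [(-4, 4)] by decide +kernel)
  have e65 := hd (show innerForm _ 6 5 = [(-3, 5)] by decide +kernel)
  have e00 := hd (show innerForm _ 0 0 = [(1, 6)] by decide +kernel)
  have e01 := hd (show innerForm _ 0 1 = [(1, 7)] by decide +kernel)
  simp [evalForm_cons, evalForm_nil]
    at e60 e61 e62 e63 e64 e65 e00 e01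
  funext i
  fin_cases i <;> simp_all

/-- The six nonzero weights are distinct, so endomorphisms of weight zero have dimension 6+4 = 10
and their coboundaries dimension 8. Eight of the 20 entries are normalized, with the first two rows
of the matrix zero, and the relations eliminate the other 12. -/
theorem cocyclesAreCoboundaries_G2 (K : Type*) [Field K] [CharZero K] :
    CocyclesAreCoboundaries (lawOfTable K tableG2 isLieLaw_G2).1 := by
  refine cocyclesAreCoboundaries_lawOfTable (s := 6) (w := ![1, 2, 3, 4, 5, 6, 0, 0])
    (by decide +kernel) (by decide +kernel)
    (fun φ => ![0,
      0,
      ![0, 0, -φ 0 1 2, 0, 0, 0, 0, 0],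
      ![0, 0, 0, -φ 0 2 3 - φ 0 1 2, 0, 0, 0, 0],
      ![0, 0, 0, 0, -φ 1 2 4 - φ 0 1 2, 0, 0, 0],
      ![0, 0, 0, 0, 0, -φ 0 4 5 - φ 1 2 4 - φ 0 1 2, 0, 0],
      ![0, 0, 0, 0, 0, 0, -φ 0 6 0, -φ 1 6 1 + 2 * φ 0 6 0],
      ![0, 0, 0, 0, 0, 0, -φ 0 7 0, -φ 1 7 1 + 2 * φ 0 7 0]]) fun φ ψ hψ hψφ i j k hij hijk => ?_
  have hd {i j k : Fin 8} {L : List (ℤ × Fin 8 × Fin 8)}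
      (hL : coboundaryForm (structConst 8 tableG2) i j k = L) :=
    (congrFun (congrFun (congrFun hψφ i) j) k).trans
      (congrArg (φ i j k - ·) (coboundaryConst_eq_evalForm _ hL))
  have hmem : (i, j, k) ∈ [(0, 1, 2), (0, 2, 3), (0, 3, 4), (0, 4, 5), (0, 6, 0), (0, 7, 0), (1, 2,
      4), (1, 3, 5), (1, 6, 1), (1, 7, 1), (2, 6, 2), (2, 7, 2), (3, 6, 3), (3, 7, 3), (4, 6, 4),
      (4, 7, 4), (5, 6, 5), (5, 7, 5), (6, 7, 6), (6, 7, 7)] := by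
    revert i j k
    decide +kernel
  have g060 : ψ 0 6 0 = 0 := by
    rw [hd (show _ = [(-1, 0, 0), (1, 0, 0), (-1, 6, 6)] by decide +kernel)]
    simp [evalForm_cons, evalForm_nil]
  have g161 : ψ 1 6 1 = 0 := by
    rw [hd (show _ = [(-2, 1, 1), (2, 1, 1), (-2, 6, 6), (-1, 6, 7)] by decide +kernel)]
    simp [evalForm_cons, evalForm_nil]
  have g070 : ψ 0 7 0 = 0 := by
    rw [hd (show _ = [(-1, 7, 6)] by decide +kernel)]
    simp [evalForm_cons, evalForm_nil]
  have g171 : ψ 1 7 1 = 0 := by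
    rw [hd (show _ = [(-1, 1, 1), (1, 1, 1), (-2, 7, 6), (-1, 7, 7)] by decide +kernel)]
    simp [evalForm_cons, evalForm_nil]
  have g012 : ψ 0 1 2 = 0 := by
    rw [hd (show _ = [(1, 0, 0), (1, 1, 1), (-1, 2, 2)] by decide +kernel)]
    simp [evalForm_cons, evalForm_nil]
  have g023 : ψ 0 2 3 = 0 := by
    rw [hd (show _ = [(1, 0, 0), (1, 2, 2), (-1, 3, 3)] by decide +kernel)]
    simp [evalForm_cons, evalForm_nil]
  have g124 : ψ 1 2 4 = 0 := by
    rw [hd (show _ = [(1, 1, 1), (1, 2, 2), (-1, 4, 4)] by decide +kernel)]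
    simp [evalForm_cons, evalForm_nil]
  have g045 : ψ 0 4 5 = 0 := by
    rw [hd (show _ = [(1, 0, 0), (1, 4, 4), (-1, 5, 5)] by decide +kernel)]
    simp [evalForm_cons, evalForm_nil]
    ring
  have e0125 := hψ.evalForm_eq_zero (show cocycleForm (structConst 8 tableG2) 0 1 2 5 =
    [(-1, 1, 3, 5), (-1, 0, 2, 3), (1, 0, 4, 5), (1, 1, 2, 4)] by decide +kernel)
  have e0162 := hψ.evalForm_eq_zero (show cocycleForm (structConst 8 tableG2) 0 1 6 2 =
    [(-1, 0, 1, 2), (1, 0, 6, 0), (-2, 0, 1, 2), (1, 1, 6, 1), (-1, 2, 6, 2), (3, 0, 1, 2)]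
        by decide +kernel)
  have e0172 := hψ.evalForm_eq_zero (show cocycleForm (structConst 8 tableG2) 0 1 7 2 =
    [(1, 0, 7, 0), (-1, 0, 1, 2), (1, 1, 7, 1), (-1, 2, 7, 2), (1, 0, 1, 2)] by decide +kernel)
  have e0263 := hψ.evalForm_eq_zero (show cocycleForm (structConst 8 tableG2) 0 2 6 3 =
    [(-1, 0, 2, 3), (1, 0, 6, 0), (-3, 0, 2, 3), (1, 2, 6, 2), (-1, 3, 6, 3), (4, 0, 2, 3)]
        by decide +kernel)
  have e0273 := hψ.evalForm_eq_zero (show cocycleForm (structConst 8 tableG2) 0 2 7 3 =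
    [(1, 0, 7, 0), (-1, 0, 2, 3), (1, 2, 7, 2), (-1, 3, 7, 3), (1, 0, 2, 3)] by decide +kernel)
  have e0374 := hψ.evalForm_eq_zero (show cocycleForm (structConst 8 tableG2) 0 3 7 4 =
    [(-1, 0, 3, 4), (2, 0, 3, 4)] by decide +kernel)
  have e0465 := hψ.evalForm_eq_zero (show cocycleForm (structConst 8 tableG2) 0 4 6 5 =
    [(-1, 0, 4, 5), (1, 0, 6, 0), (-5, 0, 4, 5), (1, 4, 6, 4), (-1, 5, 6, 5), (6, 0, 4, 5)]
        by decide +kernel)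
  have e0475 := hψ.evalForm_eq_zero (show cocycleForm (structConst 8 tableG2) 0 4 7 5 =
    [(1, 0, 7, 0), (-2, 0, 4, 5), (1, 4, 7, 4), (-1, 5, 7, 5), (2, 0, 4, 5)] by decide +kernel)
  have e0670 := hψ.evalForm_eq_zero (show cocycleForm (structConst 8 tableG2) 0 6 7 0 =
    [(-1, 0, 7, 0), (1, 0, 7, 0), (-1, 6, 7, 6)] by decide +kernel)
  have e1264 := hψ.evalForm_eq_zero (show cocycleForm (structConst 8 tableG2) 1 2 6 4 =
    [(-2, 1, 2, 4), (1, 1, 6, 1), (-3, 1, 2, 4), (1, 2, 6, 2), (-1, 4, 6, 4), (5, 1, 2, 4)]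
        by decide +kernel)
  have e1274 := hψ.evalForm_eq_zero (show cocycleForm (structConst 8 tableG2) 1 2 7 4 =
    [(-1, 1, 2, 4), (1, 1, 7, 1), (-1, 1, 2, 4), (1, 2, 7, 2), (-1, 4, 7, 4), (2, 1, 2, 4)]
        by decide +kernel)
  have e1671 := hψ.evalForm_eq_zero (show cocycleForm (structConst 8 tableG2) 1 6 7 1 =
    [(-1, 1, 6, 1), (-2, 1, 7, 1), (2, 1, 7, 1), (1, 1, 6, 1), (-2, 6, 7, 6), (-1, 6, 7, 7)]
        by decide +kernel)
  simp only [evalForm_cons, evalForm_nil, g060, g161, g070, g171, g012, g023, g124, g045]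
    at e0125 e0162 e0172 e0263 e0273 e0374 e0465 e0475 e0670 e1264
  simp only [evalForm_cons, evalForm_nil, g060, g161, g070, g171, g012, g023, g124, g045]
    at e1274 e1671
  have z034 : ψ 0 3 4 = 0 := by linear_combination e0374
  have z135 : ψ 1 3 5 = 0 := by linear_combination -e0125
  have z262 : ψ 2 6 2 = 0 := by linear_combination -e0162
  have z272 : ψ 2 7 2 = 0 := by linear_combination -e0172
  have z363 : ψ 3 6 3 = 0 := by linear_combination -e0263 - e0162
  have z373 : ψ 3 7 3 = 0 := by linear_combination -e0273 - e0172
  have z464 : ψ 4 6 4 = 0 := by linear_combination -e1264 - e0162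
  have z474 : ψ 4 7 4 = 0 := by linear_combination -e1274 - e0172
  have z565 : ψ 5 6 5 = 0 := by linear_combination -e1264 - e0162 - e0465
  have z575 : ψ 5 7 5 = 0 := by linear_combination -e1274 - e0172 - e0475
  have z676 : ψ 6 7 6 = 0 := by linear_combination -e0670
  have z677 : ψ 6 7 7 = 0 := by linear_combination -e1671 + 2 * e0670
  simp only [List.mem_cons, Prod.mk.injEq, List.not_mem_nil, or_false] at hmem
  rcases hmem with ⟨rfl, rfl, rfl⟩ | ⟨rfl, rfl, rfl⟩ | ⟨rfl, rfl, rfl⟩ | ⟨rfl, rfl, rfl⟩ | ⟨rfl,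
      rfl, rfl⟩ | ⟨rfl, rfl, rfl⟩ | ⟨rfl, rfl, rfl⟩ | ⟨rfl, rfl, rfl⟩ | ⟨rfl, rfl, rfl⟩ | ⟨rfl,
      rfl, rfl⟩ | ⟨rfl, rfl, rfl⟩ | ⟨rfl, rfl, rfl⟩ | ⟨rfl, rfl, rfl⟩ | ⟨rfl, rfl, rfl⟩ | ⟨rfl,
      rfl, rfl⟩ | ⟨rfl, rfl, rfl⟩ | ⟨rfl, rfl, rfl⟩ | ⟨rfl, rfl, rfl⟩ | ⟨rfl, rfl, rfl⟩ | ⟨rfl,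
      rfl, rfl⟩ <;> assumption

theorem derivationsAreInner_G2 (K : Type*) [Field K] [CharZero K] :
    DerivationsAreInner (lawOfTable K tableG2 isLieLaw_G2).1 := by
  -- On `X₁, X₂` the eigenvalues of `ad X₇` are `1, 2` and those of `ad X₈` are `0, 1`; solving for
  -- the diagonal entries of `f` gives these coefficients.
  refine derivationsAreInner_lawOfTable (s := 6) (w := ![1, 2, 3, 4, 5, 6, 0, 0])
    (by decide +kernel) (by decide +kernel) (fun f => ![0, 0, 0, 0, 0, 0, f 0 0, f 1 1 - 2 * f 0
        0]) fun f g hg hgf i k hik => ?_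
  have hd {i k : Fin 8} {L : List (ℤ × Fin 8)} (hL : innerForm (structConst 8 tableG2) i k = L) :=
    (congrFun (congrFun hgf i) k).trans (congrArg (f i k - ·) (innerConst_eq_evalForm _ hL))
  have he {i j k : Fin 8} {L : List (ℤ × Fin 8 × Fin 8)}
      (hL : coboundaryForm (structConst 8 tableG2) i j k = L) :=
    (coboundaryConst_eq_evalForm g hL).symm.trans (congrFun (congrFun (congrFun hg i) j) k)
  have hmem : (i, k) ∈ [(0, 0), (1, 1), (2, 2), (3, 3), (4, 4), (5, 5), (6, 6), (6, 7), (7, 6), (7,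
      7)] := by
    revert i k
    decide +kernel
  have z00 : g 0 0 = 0 := by
    rw [hd (show _ = [(1, 6)] by decide +kernel)]
    simp [evalForm_cons, evalForm_nil]
  have z11 : g 1 1 = 0 := by
    rw [hd (show _ = [(2, 6), (1, 7)] by decide +kernel)]
    simp [evalForm_cons, evalForm_nil]
  have e012 := he (show coboundaryForm _ 0 1 2 = [(1, 0, 0), (1, 1, 1), (-1, 2, 2)]
      by decide +kernel)
  have e023 := he (show coboundaryForm _ 0 2 3 = [(1, 0, 0), (1, 2, 2), (-1, 3, 3)]
      by decide +kernel)
  have e045 := he (show coboundaryForm _ 0 4 5 = [(1, 0, 0), (1, 4, 4), (-1, 5, 5)]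
      by decide +kernel)
  have e060 := he (show coboundaryForm _ 0 6 0 = [(-1, 0, 0), (1, 0, 0), (-1, 6, 6)]
      by decide +kernel)
  have e070 := he (show coboundaryForm _ 0 7 0 = [(-1, 7, 6)] by decide +kernel)
  have e124 := he (show coboundaryForm _ 1 2 4 = [(1, 1, 1), (1, 2, 2), (-1, 4, 4)]
      by decide +kernel)
  have e161 := he (show coboundaryForm _ 1 6 1 = [(-2, 1, 1), (2, 1, 1), (-2, 6, 6), (-1, 6, 7)]
      by decide +kernel)
  have e171 := he (show coboundaryForm _ 1 7 1 = [(-1, 1, 1), (1, 1, 1), (-2, 7, 6), (-1, 7, 7)]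
      by decide +kernel)
  simp only [evalForm_cons, evalForm_nil, Pi.zero_apply, z00, z11]
    at e012 e023 e045 e060 e070 e124 e161 e171
  have z22 : g 2 2 = 0 := by linear_combination -e012
  have z33 : g 3 3 = 0 := by linear_combination -e023 - e012
  have z44 : g 4 4 = 0 := by linear_combination -e124 - e012
  have z55 : g 5 5 = 0 := by linear_combination -e124 - e012 - e045
  have z66 : g 6 6 = 0 := by linear_combination -e060
  have z67 : g 6 7 = 0 := by linear_combination -e161 + 2 * e060
  have z76 : g 7 6 = 0 := by linear_combination -e070
  have z77 : g 7 7 = 0 := by linear_combination -e171 + 2 * e070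
  simp only [List.mem_cons, Prod.mk.injEq, List.not_mem_nil, or_false] at hmem
  rcases hmem with ⟨rfl, rfl⟩ | ⟨rfl, rfl⟩ | ⟨rfl, rfl⟩ | ⟨rfl, rfl⟩ | ⟨rfl, rfl⟩ | ⟨rfl, rfl⟩ |
      ⟨rfl, rfl⟩ | ⟨rfl, rfl⟩ | ⟨rfl, rfl⟩ | ⟨rfl, rfl⟩ <;> assumption

theorem eq_zero_of_innerConst_G2 (K : Type*) [Field K] [CharZero K] (x : Fin 8 → K)
    (hx : innerConst (lawOfTable K tableG2 isLieLaw_G2).1 x = 0) : x = 0 := by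
  have hd {i k : Fin 8} {L : List (ℤ × Fin 8)} (hL : innerForm (structConst 8 tableG2) i k = L) :=
    (innerConst_eq_evalForm x hL).symm.trans (congrFun (congrFun hx i) k)
  have e60 := hd (show innerForm _ 6 0 = [(-1, 0)] by decide +kernel)
  have e61 := hd (show innerForm _ 6 1 = [(-2, 1)] by decide +kernel)
  have e62 := hd (show innerForm _ 6 2 = [(-3, 2)] by decide +kernel)
  have e63 := hd (show innerForm _ 6 3 = [(-4, 3)] by decide +kernel)
  have e64 := hd (show innerForm _ 6 4 = [(-5, 4)] by decide +kernel)
  have e65 := hd (show innerForm _ 6 5 = [(-6, 5)] by decide +kernel)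
  have e00 := hd (show innerForm _ 0 0 = [(1, 6)] by decide +kernel)
  have e11 := hd (show innerForm _ 1 1 = [(2, 6), (1, 7)] by decide +kernel)
  simp [evalForm_cons, evalForm_nil]
    at e60 e61 e62 e63 e64 e65 e00 e11
  funext i
  fin_cases i <;> simp_all

end EightDimensional

/-! ### Solvability, nilpotency and the nilradical -/

theorem map_lie_of_basis {K ι L M : Type*} [Field K] [LieRing L] [LieAlgebra K L] [LieRing M]
    [LieAlgebra K M] (b : Module.Basis ι K L) (f : L →ₗ[K] M) (h : ∀ i j, f ⁅b i, b j⁆ = ⁅f (b i), f (b j)⁆)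
    (x y : L) : f ⁅x, y⁆ = ⁅f x, f y⁆ := by
  have := LinearMap.ext_basis (B := LinearMap.mk₂ K (fun x y => f ⁅x, y⁆) (by simp) (by simp)
    (by simp) (by simp)) (B' := LinearMap.mk₂ K (fun x y => ⁅f x, f y⁆) (by simp) (by simp)
    (by simp) (by simp)) b b h
  exact LinearMap.congr_fun₂ this x y

namespace LieLaw

variable {K : Type*} [Field K] [CharZero K] {n m : ℕ}

theorem lie_apply (μ : LieLaw K n) (x y : μ.Alg) (k : Fin n) :
    ⁅x, y⁆ k = ∑ i, ∑ j, x i * y j * μ.1 i j k := rfl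

/-- A law is solvable if its structure constants strictly raise some filtration of the basis. -/
theorem isSolvable_of_filtration (μ : LieLaw K n) (v : Fin n → ℕ)
    (hv : ∀ i j k, v k ≤ v i → v k ≤ v j → μ.1 i j k = 0) : LieAlgebra.IsSolvable μ.Alg := by
  -- A nonzero constant has `v k > min (v i) (v j)`, so each derived term climbs at least one level.
  have key (s : ℕ) : ∀ x ∈ LieAlgebra.derivedSeries K μ.Alg s, ∀ k, v k < s → x k = 0 := by
    induction s with
    | zero => exact fun _ _ k hk => absurd hk (Nat.not_lt_zero _)
    | succ s ih =>
      intro x hx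
      rw [LieAlgebra.derivedSeries_def, LieAlgebra.derivedSeriesOfIdeal_succ,
        ← LieSubmodule.mem_toSubmodule, LieSubmodule.lieIdeal_oper_eq_linear_span'] at hx
      induction hx using Submodule.span_induction with
      | zero => exact fun _ _ => rfl
      | add x y _ _ hx hy =>
        exact fun k hk => (congrArg₂ (· + ·) (hx k hk) (hy k hk)).trans (add_zero 0)
      | smul a x _ hx => exact fun k hk => (congrArg (a * ·) (hx k hk)).trans (mul_zero a)
      | mem x hx =>
        obtain ⟨y, hy, z, hz, rfl⟩ := hx
        intro k hk
        rw [lie_apply]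
        refine Finset.sum_eq_zero fun i _ => Finset.sum_eq_zero fun j _ => ?_
        by_cases hi : v i < s
        · rw [ih y hy i hi, zero_mul, zero_mul]
        by_cases hj : v j < s
        · rw [ih z hz j hj, mul_zero, zero_mul]
        rw [hv i j k (by omega) (by omega), mul_zero]
  refine LieAlgebra.IsSolvable.mk (R := K) (k := Finset.univ.sup v + 1)
    ((LieSubmodule.eq_bot_iff _).2 fun x hx => funext fun k => key _ x hx k ?_)
  exact Nat.lt_succ_of_le (Finset.le_sup (Finset.mem_univ k))

/-- A law is nilpotent if its structure constants strictly raise some grading of the basis. -/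
theorem isNilpotent_of_filtration (μ : LieLaw K n) (v : Fin n → ℕ)
    (hv : ∀ i j k, v k ≤ v j → μ.1 i j k = 0) : LieRing.IsNilpotent μ.Alg := by
  have key (s : ℕ) : ∀ x ∈ LieModule.lowerCentralSeries K μ.Alg μ.Alg s,
      ∀ k, v k < s → x k = 0 := by
    induction s with
    | zero => exact fun _ _ k hk => absurd hk (Nat.not_lt_zero _)
    | succ s ih =>
      intro x hx
      rw [LieModule.lowerCentralSeries_succ, ← LieSubmodule.mem_toSubmodule,
        LieSubmodule.lieIdeal_oper_eq_linear_span'] at hx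
      induction hx using Submodule.span_induction with
      | zero => exact fun _ _ => rfl
      | add x y _ _ hx hy =>
        exact fun k hk => (congrArg₂ (· + ·) (hx k hk) (hy k hk)).trans (add_zero 0)
      | smul a x _ hx => exact fun k hk => (congrArg (a * ·) (hx k hk)).trans (mul_zero a)
      | mem x hx =>
        obtain ⟨y, -, z, hz, rfl⟩ := hx
        intro k hk
        rw [lie_apply]
        refine Finset.sum_eq_zero fun i _ => Finset.sum_eq_zero fun j _ => ?_
        by_cases hj : v j < s
        · rw [ih z hz j hj, mul_zero, zero_mul]
        rw [hv i j k (by omega), mul_zero]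
  refine (LieModule.isNilpotent_iff K μ.Alg μ.Alg).2 ⟨Finset.univ.sup v + 1,
    (LieSubmodule.eq_bot_iff _).2 fun x hx => funext fun k => key _ x hx k ?_⟩
  exact Nat.lt_succ_of_le (Finset.le_sup (Finset.mem_univ k))

/-- The ideal of vectors whose coordinates in `S` vanish, when no bracket has such a coordinate. -/
def coordIdeal (μ : LieLaw K n) (S : Finset (Fin n)) (hS : ∀ i j, ∀ k ∈ S, μ.1 i j k = 0) :
    LieIdeal K μ.Alg where
  carrier := {x | ∀ k ∈ S, x k = 0}
  add_mem' hx hy k hk := (congrArg₂ (· + ·) (hx k hk) (hy k hk)).trans (add_zero 0)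
  zero_mem' _ _ := rfl
  smul_mem' a _ hx k hk := (congrArg (a * ·) (hx k hk)).trans (mul_zero a)
  lie_mem := by
    intro x y _ k hk
    rw [lie_apply]
    exact Finset.sum_eq_zero fun i _ => Finset.sum_eq_zero fun j _ => by
      rw [hS i j k hk, mul_zero]

theorem mem_coordIdeal {μ : LieLaw K n} {S : Finset (Fin n)}
    {hS : ∀ i j, ∀ k ∈ S, μ.1 i j k = 0} {x : μ.Alg} :
    x ∈ μ.coordIdeal S hS ↔ ∀ k ∈ S, x k = 0 := Iff.rfl

/-- The linear map between laws given by the matrix of the images of the basis vectors. -/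
def mapOfMatrix (μ : LieLaw K m) (ν : LieLaw K n) (P : Matrix (Fin m) (Fin n) K) :
    μ.Alg →ₗ[K] ν.Alg := P.vecMulLinear

theorem mapOfMatrix_apply (μ : LieLaw K m) (ν : LieLaw K n) (P : Matrix (Fin m) (Fin n) K)
    (x : μ.Alg) : mapOfMatrix μ ν P x = Matrix.vecMul x P := rfl

theorem mapOfMatrix_basis (μ : LieLaw K m) (ν : LieLaw K n) (P : Matrix (Fin m) (Fin n) K)
    (i : Fin m) : mapOfMatrix μ ν P (μ.basis i) = P i := by
  rw [mapOfMatrix_apply, basis_apply]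
  exact Matrix.single_one_vecMul i P

theorem mapOfMatrix_lie (μ : LieLaw K m) (ν : LieLaw K n) (P : Matrix (Fin m) (Fin n) K)
    (hP : ∀ i j k, ∑ l, μ.1 i j l * P l k = ∑ a, ∑ b, P i a * P j b * ν.1 a b k) (x y : μ.Alg) :
    mapOfMatrix μ ν P ⁅x, y⁆ = ⁅mapOfMatrix μ ν P x, mapOfMatrix μ ν P y⁆ := by
  refine map_lie_of_basis μ.basis (mapOfMatrix μ ν P) (fun i j => funext fun k => ?_) x y
  rw [mapOfMatrix_basis, mapOfMatrix_basis]
  change ∑ l, ⁅μ.basis i, μ.basis j⁆ l * P l k = _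
  refine Eq.trans (Finset.sum_congr rfl fun l _ => ?_) (hP i j k)
  exact congrArg (· * P l k) (lie_basis_basis μ i j l)

end LieLaw

/-- If `ad x`, for `x` in a nilpotent ideal, acts on a stable subspace through a functional `ρ`
by a scalar, then this scalar is zero. -/
theorem eq_zero_of_mem_nilpotent_ideal {K F L : Type*} [Field K] [Field F] [LieRing L]
    [LieAlgebra K L] (I J : LieIdeal K L) [LieRing.IsNilpotent J] {x : L} (hx : x ∈ J) (ρ : L → F)
    (hρ : ρ 0 = 0) {z : F} (hz : ∀ y ∈ I, ρ ⁅x, y⁆ = z * ρ y) {y : L} (hy : y ∈ I) (hy0 : ρ y ≠ 0) :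
    z = 0 := by
  obtain ⟨N, hN⟩ := LieModule.isNilpotent_toEnd_of_isNilpotent K J J ⟨x, hx⟩
  have h1 (s : ℕ) : ((LieModule.toEnd K L L x) ^ s) y ∈ I ∧
      ρ (((LieModule.toEnd K L L x) ^ s) y) = z ^ s * ρ y := by
    induction s with
    | zero => simpa using hy
    | succ s ih =>
      rw [pow_succ', Module.End.mul_apply, LieModule.toEnd_apply_apply]
      exact ⟨I.lie_mem ih.1, by rw [hz _ ih.1, ih.2, pow_succ']; ring⟩
  have h2 (s : ℕ) (u : J) : (((LieModule.toEnd K J J ⟨x, hx⟩) ^ s) u : L) =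
      ((LieModule.toEnd K L L x) ^ s) u := by
    induction s with
    | zero => rfl
    | succ s ih =>
      rw [pow_succ', Module.End.mul_apply, pow_succ', Module.End.mul_apply, ← ih]
      rfl
  -- The first application of `ad x` lands in the ideal `J`, where `N` further ones give zero; hence
  -- the exponent `N + 1`.
  have h3 : ((LieModule.toEnd K L L x) ^ (N + 1)) y = 0 := by
    rw [pow_succ, Module.End.mul_apply, LieModule.toEnd_apply_apply]
    have hxy : ⁅x, y⁆ ∈ J := lie_mem_left K L J x y hx
    rw [← h2 N ⟨_, hxy⟩, hN]
    rfl
  have h4 := (h1 (N + 1)).2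
  rw [h3, hρ] at h4
  exact eq_zero_of_pow_eq_zero ((mul_eq_zero.1 h4.symm).resolve_right hy0)

/-! ### Brackets of table laws as sparse bilinear forms -/

section Tables

variable {K : Type*} [Field K] [CharZero K] {n : ℕ} {t : ℕ → ℕ → ℕ → ℤ}
  {h : IsLieLaw (structConst n t)}

/-- The coordinate `k` of the bracket of two vectors, as a linear form in the products of their
coordinates. -/
def bracketForm (c : Fin n → Fin n → Fin n → ℤ) (k : Fin n) : List (ℤ × Fin n × Fin n) :=
  ((List.finRange n).flatMap fun i => (List.finRange n).map fun j => (c i j k, i, j)).filter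
    fun p => p.1 ≠ 0

theorem lie_eq_evalForm {k : Fin n} {L : List (ℤ × Fin n × Fin n)}
    (hL : bracketForm (structConst n t) k = L) (x y : (lawOfTable K t h).Alg) :
    ⁅x, y⁆ k = evalForm (fun p => x p.1 * y p.2) L := by
  rw [← hL, bracketForm, evalForm_filter, evalForm_flatMap, ← Fin.sum_univ_def, LieLaw.lie_apply]
  refine Finset.sum_congr rfl fun i _ => ?_
  rw [evalForm, List.map_map, ← Fin.sum_univ_def]
  exact Finset.sum_congr rfl fun j _ => mul_comm _ _

theorem lawOfTable_eq_zero {i j k : Fin n} (hc : structConst n t i j k = 0) :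
    (lawOfTable K t h).1 i j k = 0 := by
  change ((structConst n t i j k : ℤ) : K) = 0
  rw [hc, Int.cast_zero]

end Tables

/-! ### Isomorphisms given by matrices -/

section Nilradical

theorem eq_zero_of_vecMul_eq_zero {K : Type*} [Field K] {m n : ℕ} {P : Matrix (Fin m) (Fin n) K}
    {Q : Matrix (Fin n) (Fin m) K} {a : K} (ha : a ≠ 0) (h : P * Q = a • 1) {x : Fin m → K}
    (hx : Matrix.vecMul x P = 0) : x = 0 := by
  have h2 := congrArg (fun v => Matrix.vecMul v Q) hx
  simp only [Matrix.vecMul_vecMul, h, Matrix.vecMul_smul, Matrix.vecMul_one,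
    Matrix.zero_vecMul] at h2
  exact (smul_eq_zero.1 h2).resolve_left ha

variable {n m : ℕ} {t u : ℕ → ℕ → ℕ → ℤ} {ht : IsLieLaw (structConst n t)}
  {hu : IsLieLaw (structConst m u)}

/-- A coordinate ideal is isomorphic to the law `u` when an integral matrix, invertible up to a
nonzero scalar, respects the brackets. -/
theorem nonempty_coordIdeal_equiv {K : Type*} [Field K] [CharZero K] (S : Finset (Fin n))
    (hS : ∀ i j, ∀ k ∈ S, (lawOfTable K t ht).1 i j k = 0)
    (P : Matrix (Fin m) (Fin n) ℤ) (Q : Matrix (Fin n) (Fin m) ℤ) {d : ℤ} (hd : d ≠ 0)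
    (hP : ∀ i j k, ∑ l, structConst m u i j l * P l k =
      ∑ a, ∑ b, P i a * P j b * structConst n t a b k)
    (hPS : ∀ k ∈ S, ∀ i, P i k = 0) (hPQ : P * Q = d • 1)
    (hQP : ∀ a k, a ∉ S → (Q * P) a k = if a = k then d else 0) :
    Nonempty ((lawOfTable K t ht).coordIdeal S hS ≃ₗ⁅K⁆ (lawOfTable K u hu).Alg) := by
  have hd' : (d : K) ≠ 0 := Int.cast_ne_zero.2 hd
  let PK : Matrix (Fin m) (Fin n) K := P.map (Int.castRingHom K)
  let QK : Matrix (Fin n) (Fin m) K := Q.map (Int.castRingHom K)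
  have hPQK : PK * QK = (d : K) • (1 : Matrix (Fin m) (Fin m) K) := by
    rw [← Matrix.map_mul, hPQ]
    ext i j
    change ((d * (1 : Matrix (Fin m) (Fin m) ℤ) i j : ℤ) : K) = d * (1 : Matrix _ _ K) i j
    rw [Matrix.one_apply, Matrix.one_apply]
    split_ifs <;> simp
  have hmem (x : (lawOfTable K u hu).Alg) :
      LieLaw.mapOfMatrix _ (lawOfTable K t ht) PK x ∈ (lawOfTable K t ht).coordIdeal S hS := by
    refine LieLaw.mem_coordIdeal.2 fun k hk => ?_
    change ∑ i, x i * PK i k = 0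
    refine Finset.sum_eq_zero fun i _ => ?_
    simp [PK, hPS k hk i]
  have hlie := LieLaw.mapOfMatrix_lie (lawOfTable K u hu) (lawOfTable K t ht) PK fun i j k => by
    have h := congrArg (Int.cast (R := K)) (hP i j k)
    simp only [Int.cast_sum, Int.cast_mul] at h
    exact h
  let f : (lawOfTable K u hu).Alg →ₗ⁅K⁆ (lawOfTable K t ht).coordIdeal S hS :=
    { (LieLaw.mapOfMatrix _ (lawOfTable K t ht) PK).codRestrict
        ((lawOfTable K t ht).coordIdeal S hS).toSubmodule hmem with
      map_lie' := fun {x y} => Subtype.ext (hlie x y) }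
  refine ⟨(LieEquiv.ofBijective f ⟨?_, fun y => ?_⟩).symm⟩
  · refine (injective_iff_map_eq_zero f).2 fun x hx => ?_
    exact eq_zero_of_vecMul_eq_zero hd' hPQK (congrArg Subtype.val hx)
  · let z : (lawOfTable K u hu).Alg := Matrix.vecMul (y.1 : Fin n → K) QK
    suffices hz : f z = (d : K) • y from
      ⟨(d : K)⁻¹ • z, by rw [map_smul, hz, inv_smul_smul₀ hd']⟩
    refine Subtype.ext ?_
    change Matrix.vecMul (Matrix.vecMul (y.1 : Fin n → K) QK) PK = (d : K) • (y.1 : Fin n → K)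
    refine (Matrix.vecMul_vecMul (y.1 : Fin n → K) QK PK).trans ?_
    rw [← Matrix.map_mul]
    funext k
    change ∑ a, y.1 a * (((Q * P) a k : ℤ) : K) = d * y.1 k
    rw [Finset.sum_eq_single k]
    · by_cases hk : k ∈ S
      · simp [LieLaw.mem_coordIdeal.1 y.2 k hk]
      · rw [hQP k k hk, if_pos rfl, mul_comm]
    · intro a _ hak
      by_cases ha : a ∈ S
      · rw [LieLaw.mem_coordIdeal.1 y.2 a ha, zero_mul]
      · rw [hQP a k ha, if_neg hak, Int.cast_zero, mul_zero]
    · simp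

end Nilradical

/-! ### Complexifications and Gaussian changes of basis -/

section RealForms

variable {n : ℕ} {t u : ℕ → ℕ → ℕ → ℤ} {ht : IsLieLaw (structConst n t)}
  {hu : IsLieLaw (structConst n u)}

/-- The complexification of a real law with integral structure constants. -/
theorem isRealForm_lawOfTable (t : ℕ → ℕ → ℕ → ℤ) (ht : IsLieLaw (structConst n t)) :
    IsRealForm (lawOfTable ℝ t ht).Alg (lawOfTable ℂ t ht).Alg := by
  let b := (lawOfTable ℝ t ht).basis.baseChange ℂ
  let e := b.equiv (lawOfTable ℂ t ht).basis (Equiv.refl _)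
  have he (i : Fin n) : e (1 ⊗ₜ (lawOfTable ℝ t ht).basis i) = (lawOfTable ℂ t ht).basis i := by
    rw [← Module.Basis.baseChange_apply]
    exact b.equiv_apply _ _ _
  refine ⟨{ e with map_lie' := fun {x y} => map_lie_of_basis b e.toLinearMap (fun i j => ?_) x y }⟩
  change e ⁅b i, b j⁆ = ⁅e (b i), e (b j)⁆
  rw [Module.Basis.baseChange_apply, Module.Basis.baseChange_apply,
    LieAlgebra.ExtendScalars.bracket_tmul, he, he, one_mul,
    ← (lawOfTable ℝ t ht).sum_smul_basis ⁅_, _⁆, TensorProduct.tmul_sum, map_sum,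
    ← (lawOfTable ℂ t ht).sum_smul_basis ⁅_, _⁆]
  refine Finset.sum_congr rfl fun k _ => ?_
  rw [TensorProduct.tmul_smul, ← algebraMap_smul ℂ, map_smul, he, LieLaw.lie_basis_basis,
    LieLaw.lie_basis_basis]
  exact congrArg (· • (lawOfTable ℂ t ht).basis k) (map_intCast (algebraMap ℝ ℂ) _)

/-- Two complex laws with integral structure constants are isomorphic when the Gaussian matrix
`(A + i B) / d`, with inverse `(C + i D) / d'`, respects the brackets. -/
theorem nonempty_lieEquiv_of_gaussian (A B C D : Matrix (Fin n) (Fin n) ℤ) {d d' : ℤ}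
    (hd : d ≠ 0) (hd' : d' ≠ 0) (hAC : A * C - B * D = d' • 1) (hAD : A * D + B * C = 0)
    (hre : ∀ i j k, d * ∑ l, structConst n u i j l * A l k =
      ∑ a, ∑ b, (A i a * A j b - B i a * B j b) * structConst n t a b k)
    (him : ∀ i j k, d * ∑ l, structConst n u i j l * B l k =
      ∑ a, ∑ b, (A i a * B j b + B i a * A j b) * structConst n t a b k) :
    Nonempty ((lawOfTable ℂ u hu).Alg ≃ₗ⁅ℂ⁆ (lawOfTable ℂ t ht).Alg) := by
  have hdC : (d : ℂ) ≠ 0 := Int.cast_ne_zero.2 hd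
  have hdC' : (d' : ℂ) ≠ 0 := Int.cast_ne_zero.2 hd'
  let P : Matrix (Fin n) (Fin n) ℂ := fun i k => (d : ℂ)⁻¹ * (A i k + Complex.I * B i k)
  let Q : Matrix (Fin n) (Fin n) ℂ := fun i k => C i k + Complex.I * D i k
  have hPQ : P * Q = ((d : ℂ)⁻¹ * d') • (1 : Matrix (Fin n) (Fin n) ℂ) := by
    ext i j
    have h1 := congrArg (Int.cast (R := ℂ)) (congrFun (congrFun hAC i) j)
    have h2 := congrArg (Int.cast (R := ℂ)) (congrFun (congrFun hAD i) j)
    simp only [Matrix.sub_apply, Matrix.add_apply, Matrix.mul_apply, Matrix.smul_apply,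
      Matrix.zero_apply, smul_eq_mul, Int.cast_sub, Int.cast_add, Int.cast_sum, Int.cast_mul,
      Int.cast_zero, ← Finset.sum_add_distrib, ← Finset.sum_sub_distrib] at h1 h2
    have h3 : (P * Q) i j = (d : ℂ)⁻¹ * (∑ x, ((A i x : ℂ) * C x j - B i x * D x j) +
        Complex.I * ∑ x, ((A i x : ℂ) * D x j + B i x * C x j)) := by
      rw [Matrix.mul_apply, Finset.mul_sum, ← Finset.sum_add_distrib, Finset.mul_sum]
      refine Finset.sum_congr rfl fun x _ => ?_
      linear_combination (d : ℂ)⁻¹ * B i x * D x j * Complex.I_sq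
    rw [h3, h1, h2, mul_zero, add_zero, Matrix.smul_apply, Matrix.one_apply, Matrix.one_apply,
      smul_eq_mul, mul_assoc]
    split_ifs <;> simp
  have hlie := LieLaw.mapOfMatrix_lie (lawOfTable ℂ u hu) (lawOfTable ℂ t ht) P fun i j k => by
    have h1 := congrArg (Int.cast (R := ℂ)) (hre i j k)
    have h2 := congrArg (Int.cast (R := ℂ)) (him i j k)
    simp only [Int.cast_sub, Int.cast_add, Int.cast_sum, Int.cast_mul] at h1 h2
    have h3 : ∑ a, ∑ b, P i a * P j b * (lawOfTable ℂ t ht).1 a b k =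
        (d : ℂ)⁻¹ * (d : ℂ)⁻¹ * (∑ a, ∑ b, ((A i a : ℂ) * A j b - B i a * B j b) *
            structConst n t a b k +
          Complex.I * ∑ a, ∑ b, ((A i a : ℂ) * B j b + B i a * A j b) * structConst n t a b k) := by
      simp only [Finset.mul_sum, ← Finset.sum_add_distrib]
      refine Finset.sum_congr rfl fun a _ => Finset.sum_congr rfl fun b _ => ?_
      change (d : ℂ)⁻¹ * (A i a + Complex.I * B i a) * ((d : ℂ)⁻¹ * (A j b + Complex.I * B j b)) *
        (structConst n t a b k : ℂ) = _
      linear_combination (d : ℂ)⁻¹ * (d : ℂ)⁻¹ * B i a * B j b * structConst n t a b k * Complex.I_sq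
    have h4 : ∑ l, (lawOfTable ℂ u hu).1 i j l * P l k =
        (d : ℂ)⁻¹ * (∑ l, (structConst n u i j l : ℂ) * A l k +
          Complex.I * ∑ l, (structConst n u i j l : ℂ) * B l k) := by
      simp only [Finset.mul_sum, ← Finset.sum_add_distrib]
      refine Finset.sum_congr rfl fun l _ => ?_
      change (structConst n u i j l : ℂ) * ((d : ℂ)⁻¹ * (A l k + Complex.I * B l k)) = _
      ring
    rw [h3, h4, ← h1, ← h2]
    field_simp
  have hinj : Function.Injective (LieLaw.mapOfMatrix (lawOfTable ℂ u hu) (lawOfTable ℂ t ht) P) := by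
    refine (injective_iff_map_eq_zero _).2 fun x hx => ?_
    exact eq_zero_of_vecMul_eq_zero (mul_ne_zero (inv_ne_zero hdC) hdC') hPQ hx
  let f : (lawOfTable ℂ u hu).Alg →ₗ⁅ℂ⁆ (lawOfTable ℂ t ht).Alg :=
    { LieLaw.mapOfMatrix (lawOfTable ℂ u hu) (lawOfTable ℂ t ht) P with
      map_lie' := fun {x y} => hlie x y }
  refine ⟨LieEquiv.ofBijective f ⟨hinj, ?_⟩⟩
  refine (LinearMap.injective_iff_surjective_of_finrank_eq_finrank ?_).1 hinj
  rw [LieLaw.finrank_alg, LieLaw.finrank_alg]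

end RealForms

/-! ### The two algebras -/

section MainResults

/-- The levels encode the flag from the whole algebra to `⟨X₁, …, X₆⟩`, then to the abelian ideal
`⟨X₃, …, X₆⟩`, then to zero. -/
theorem isSolvable_lawG1 : LieAlgebra.IsSolvable lawG1.Alg :=
  lawG1.isSolvable_of_filtration ![1, 1, 2, 2, 2, 2, 0, 0] fun _ _ _ hi hj =>
    lawOfTable_eq_zero ((by decide +kernel : ∀ i j k : Fin 8,
      (![1, 1, 2, 2, 2, 2, 0, 0] : Fin 8 → ℕ) k ≤ ![1, 1, 2, 2, 2, 2, 0, 0] i →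
      (![1, 1, 2, 2, 2, 2, 0, 0] : Fin 8 → ℕ) k ≤ ![1, 1, 2, 2, 2, 2, 0, 0] j →
      structConst 8 tableG1 i j k = 0) _ _ _ hi hj)

theorem isSolvable_lawG2 : LieAlgebra.IsSolvable lawG2.Alg :=
  lawG2.isSolvable_of_filtration ![1, 1, 2, 2, 2, 2, 0, 0] fun _ _ _ hi hj =>
    lawOfTable_eq_zero ((by decide +kernel : ∀ i j k : Fin 8,
      (![1, 1, 2, 2, 2, 2, 0, 0] : Fin 8 → ℕ) k ≤ ![1, 1, 2, 2, 2, 2, 0, 0] i →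
      (![1, 1, 2, 2, 2, 2, 0, 0] : Fin 8 → ℕ) k ≤ ![1, 1, 2, 2, 2, 2, 0, 0] j →
      structConst 8 tableG2 i j k = 0) _ _ _ hi hj)

theorem isNilpotent_lawN66 : LieRing.IsNilpotent lawN66.Alg :=
  lawN66.isNilpotent_of_filtration ![1, 1, 2, 3, 4, 3] fun _ _ _ hj =>
    lawOfTable_eq_zero ((by decide +kernel : ∀ i j k : Fin 6,
      (![1, 1, 2, 3, 4, 3] : Fin 6 → ℕ) k ≤ ![1, 1, 2, 3, 4, 3] j →
      structConst 6 tableN66 i j k = 0) _ _ _ hj)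

theorem isNilpotent_lawN67 : LieRing.IsNilpotent lawN67.Alg :=
  lawN67.isNilpotent_of_filtration ![1, 1, 2, 3, 4, 3] fun _ _ _ hj =>
    lawOfTable_eq_zero ((by decide +kernel : ∀ i j k : Fin 6,
      (![1, 1, 2, 3, 4, 3] : Fin 6 → ℕ) k ≤ ![1, 1, 2, 3, 4, 3] j →
      structConst 6 tableN67 i j k = 0) _ _ _ hj)

/-- The span of `X₁, …, X₆` in the first algebra. -/
noncomputable def nilIdealG1 : LieIdeal ℝ lawG1.Alg :=
  lawG1.coordIdeal {6, 7} fun _ _ _ hk => lawOfTable_eq_zero ((by decide +kernel :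
    ∀ i j : Fin 8, ∀ k ∈ ({6, 7} : Finset (Fin 8)), structConst 8 tableG1 i j k = 0) _ _ _ hk)

/-- The span of `X₁, …, X₆` in the second algebra. -/
noncomputable def nilIdealG2 : LieIdeal ℝ lawG2.Alg :=
  lawG2.coordIdeal {6, 7} fun _ _ _ hk => lawOfTable_eq_zero ((by decide +kernel :
    ∀ i j : Fin 8, ∀ k ∈ ({6, 7} : Finset (Fin 8)), structConst 8 tableG2 i j k = 0) _ _ _ hk)

theorem nonempty_nilIdealG1_equiv : Nonempty (nilIdealG1 ≃ₗ⁅ℝ⁆ lawN66.Alg) :=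
  nonempty_coordIdeal_equiv (d := 1) {6, 7} _ (fun i a => if (i : ℕ) = a then 1 else 0)
    (fun a i => if (i : ℕ) = a then 1 else 0) one_ne_zero (by decide +kernel) (by decide +kernel)
    (by decide +kernel) (by decide +kernel)

/-- The generators of `N_{6,7}` go to `X₁ + X₂` and `X₁ - X₂`, and its brackets force the other
rows: `-2X₃`, `-2X₄ - 2X₅`, `-4X₆`, `-2X₄ + 2X₅`. The second matrix is four times the inverse on the
ideal. -/
theorem nonempty_nilIdealG2_equiv : Nonempty (nilIdealG2 ≃ₗ⁅ℝ⁆ lawN67.Alg) :=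
  nonempty_coordIdeal_equiv (d := 4) {6, 7} _
    !![1, 1, 0, 0, 0, 0, 0, 0;
       1, -1, 0, 0, 0, 0, 0, 0;
       0, 0, -2, 0, 0, 0, 0, 0;
       0, 0, 0, -2, -2, 0, 0, 0;
       0, 0, 0, 0, 0, -4, 0, 0;
       0, 0, 0, -2, 2, 0, 0, 0]
    !![2, 2, 0, 0, 0, 0;
       2, -2, 0, 0, 0, 0;
       0, 0, -2, 0, 0, 0;
       0, 0, 0, -1, 0, -1;
       0, 0, 0, -1, 0, 1;
       0, 0, 0, 0, -1, 0;
       0, 0, 0, 0, 0, 0;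
       0, 0, 0, 0, 0, 0] (by decide) (by decide +kernel) (by decide +kernel)
    (by decide +kernel) (by decide +kernel)

theorem isRealForm_lawG1 : IsRealForm lawG1.Alg lawR822.Alg := by
  obtain ⟨e⟩ := isRealForm_lawOfTable tableG1 isLieLaw_G1
  -- The generators `X₁, X₂` of `r₈²²` go to `X₁ ∓ iX₂`, eigenvectors of `ad X₈` for `±i`. For the
  -- weights to be `(1, 2)` and `(0, 1)`, `X₇` and `X₈` must go to `(3X₇ + iX₈)/2` and `(X₇ +
  -- iX₈)/2`, whence `d = 2`. The remaining rows follow from the brackets.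
  obtain ⟨e'⟩ := nonempty_lieEquiv_of_gaussian (n := 8) (t := tableG1) (u := tableG2)
    (ht := isLieLaw_G1) (hu := isLieLaw_G2) (d := 2) (d' := 8)
    !![2, 0, 0, 0, 0, 0, 0, 0;
       2, 0, 0, 0, 0, 0, 0, 0;
       0, 0, 0, 0, 0, 0, 0, 0;
       0, 0, 0, 0, 0, -4, 0, 0;
       0, 0, 0, 0, 0, 4, 0, 0;
       0, 0, 0, 0, 0, 0, 0, 0;
       0, 0, 0, 0, 0, 0, 3, 0;
       0, 0, 0, 0, 0, 0, 1, 0]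
    !![0, -2, 0, 0, 0, 0, 0, 0;
       0, 2, 0, 0, 0, 0, 0, 0;
       0, 0, 4, 0, 0, 0, 0, 0;
       0, 0, 0, 4, 0, 0, 0, 0;
       0, 0, 0, 4, 0, 0, 0, 0;
       0, 0, 0, 0, 8, 0, 0, 0;
       0, 0, 0, 0, 0, 0, 0, 1;
       0, 0, 0, 0, 0, 0, 0, 1]
    !![2, 2, 0, 0, 0, 0, 0, 0;
       0, 0, 0, 0, 0, 0, 0, 0;
       0, 0, 0, 0, 0, 0, 0, 0;
       0, 0, 0, 0, 0, 0, 0, 0;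
       0, 0, 0, 0, 0, 0, 0, 0;
       0, 0, 0, -1, 1, 0, 0, 0;
       0, 0, 0, 0, 0, 0, 4, -4;
       0, 0, 0, 0, 0, 0, 0, 0]
    !![0, 0, 0, 0, 0, 0, 0, 0;
       2, -2, 0, 0, 0, 0, 0, 0;
       0, 0, -2, 0, 0, 0, 0, 0;
       0, 0, 0, -1, -1, 0, 0, 0;
       0, 0, 0, 0, 0, -1, 0, 0;
       0, 0, 0, 0, 0, 0, 0, 0;
       0, 0, 0, 0, 0, 0, 0, 0;
       0, 0, 0, 0, 0, 0, 4, -12]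
    (by decide) (by decide) (by decide +kernel) (by decide +kernel) (by decide +kernel)
    (by decide +kernel)
  exact ⟨e.trans e'.symm⟩

theorem isNilradical_nilIdealG1 : IsNilradical nilIdealG1 := by
  refine ⟨nonempty_nilIdealG1_equiv.some.nilpotent_iff_equiv_nilpotent.2 isNilpotent_lawN66,
    fun J hJ x hx => ?_⟩
  have : LieRing.IsNilpotent J := hJ
  have hb (x y : lawG1.Alg) (k : Fin 8) (L) (hL : bracketForm (structConst 8 tableG1) k = L) :
      ⁅x, y⁆ k = evalForm (fun p => x p.1 * y p.2) L := lie_eq_evalForm hL x y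
  -- No real eigenvector is available here: with the first two coordinates of `y` read as one
  -- complex number, `ad x` multiplies it by `x 6 + i x 7`.
  have hz : (⟨x 6, x 7⟩ : ℂ) = 0 := by
    refine eq_zero_of_mem_nilpotent_ideal nilIdealG1 J hx
      (fun y : lawG1.Alg => (⟨y 0, y 1⟩ : ℂ)) (Complex.ext rfl rfl) (fun y hy => ?_)
      (y := lawG1.basis 0) ?_ ?_
    · have h6 : y 6 = 0 := hy 6 (by simp)
      have h7 : y 7 = 0 := hy 7 (by simp)
      refine Complex.ext ?_ ?_
      · change ⁅x, y⁆ 0 = x 6 * y 0 - x 7 * y 1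
        rw [hb x y 0 [(-1, 0, 6), (1, 1, 7), (1, 6, 0), (-1, 7, 1)] (by decide +kernel)]
        simp only [evalForm_cons, evalForm_nil, h6, h7]
        push_cast
        ring
      · change ⁅x, y⁆ 1 = x 6 * y 1 + x 7 * y 0
        rw [hb x y 1 [(-1, 0, 7), (-1, 1, 6), (1, 6, 1), (1, 7, 0)] (by decide +kernel)]
        simp only [evalForm_cons, evalForm_nil, h6, h7]
        push_cast
        ring
    · rw [LieLaw.basis_apply]
      refine LieLaw.mem_coordIdeal.2 fun k hk => Pi.single_eq_of_ne ?_ _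
      rintro rfl
      revert hk
      decide
    · rw [LieLaw.basis_apply]
      intro h0
      have h1 : (Pi.single 0 1 : Fin 8 → ℝ) 0 = 0 := congrArg Complex.re h0
      rw [Pi.single_eq_same] at h1
      exact one_ne_zero h1
  refine LieLaw.mem_coordIdeal.2 fun k hk => ?_
  rcases Finset.mem_insert.1 hk with rfl | hk
  · exact congrArg Complex.re hz
  · rw [Finset.mem_singleton.1 hk]
    exact congrArg Complex.im hz

theorem isNilradical_nilIdealG2 : IsNilradical nilIdealG2 := by
  refine ⟨nonempty_nilIdealG2_equiv.some.nilpotent_iff_equiv_nilpotent.2 isNilpotent_lawN67,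
    fun J hJ x hx => ?_⟩
  have : LieRing.IsNilpotent J := hJ
  have hb (x y : lawG2.Alg) (k : Fin 8) (L) (hL : bracketForm (structConst 8 tableG2) k = L) :
      ⁅x, y⁆ k = evalForm (fun p => x p.1 * y p.2) L := lie_eq_evalForm hL x y
  have hmem (i : Fin 8) (hi : i ∉ ({6, 7} : Finset (Fin 8))) : lawG2.basis i ∈ nilIdealG2 := by
    rw [LieLaw.basis_apply]
    refine LieLaw.mem_coordIdeal.2 fun k hk => Pi.single_eq_of_ne ?_ _
    rintro rfl
    exact hi hk
  have hne (i : Fin 8) : (lawG2.basis i) i ≠ 0 := by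
    rw [LieLaw.basis_apply]
    change (Pi.single i 1 : Fin 8 → ℝ) i ≠ 0
    rw [Pi.single_eq_same]
    exact one_ne_zero
  have h6 : x 6 = 0 := by
    refine eq_zero_of_mem_nilpotent_ideal nilIdealG2 J hx (fun y : lawG2.Alg => y 0) rfl
      (fun y hy => ?_) (hmem 0 (by decide)) (hne 0)
    have h6 : y 6 = 0 := hy 6 (by simp)
    change ⁅x, y⁆ 0 = x 6 * y 0
    rw [hb x y 0 [(-1, 0, 6), (1, 6, 0)] (by decide +kernel)]
    simp only [evalForm_cons, evalForm_nil, h6]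
    push_cast
    ring
  have h7 : 2 * x 6 + x 7 = 0 := by
    refine eq_zero_of_mem_nilpotent_ideal nilIdealG2 J hx (fun y : lawG2.Alg => y 1) rfl
      (fun y hy => ?_) (hmem 1 (by decide)) (hne 1)
    have h6 : y 6 = 0 := hy 6 (by simp)
    have h7 : y 7 = 0 := hy 7 (by simp)
    change ⁅x, y⁆ 1 = (2 * x 6 + x 7) * y 1
    rw [hb x y 1 [(-2, 1, 6), (-1, 1, 7), (2, 6, 1), (1, 7, 1)] (by decide +kernel)]
    simp only [evalForm_cons, evalForm_nil, h6, h7]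
    push_cast
    ring
  rw [h6, mul_zero, zero_add] at h7
  refine LieLaw.mem_coordIdeal.2 fun k hk => ?_
  rcases Finset.mem_insert.1 hk with rfl | hk
  · exact h6
  · rw [Finset.mem_singleton.1 hk]
    exact h7

/-- The operator `ad X₈` of the first algebra acts as a rotation on the span of `X₁` and `X₂`. -/
theorem hasEigenvalue_ad_lawG1 {s : ℂ} (hs : s * s = -1) :
    Module.End.HasEigenvalue
      ((LieAlgebra.ad ℝ lawG1.Alg (lawG1.basisVec 7)).baseChange ℂ) s := by
  have hb (i k : Fin 8) : ⁅lawG1.basis 7, lawG1.basis i⁆ k = structConst 8 tableG1 7 i k :=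
    LieLaw.lie_basis_basis _ _ _ _
  have h7 : lawG1.basisVec 7 = lawG1.basis 7 := (lawG1.basis_apply 7).symm
  have h0 : LieAlgebra.ad ℝ lawG1.Alg (lawG1.basisVec 7) (lawG1.basis 0) = lawG1.basis 1 := by
    rw [LieAlgebra.ad_apply, h7]
    refine funext fun k => (hb 0 k).trans ?_
    rw [(by decide +kernel : ∀ k : Fin 8, structConst 8 tableG1 7 0 k = if k = 1 then 1 else 0),
      LieLaw.basis_apply, Pi.single_apply]
    split_ifs <;> simp
  have h1 : LieAlgebra.ad ℝ lawG1.Alg (lawG1.basisVec 7) (lawG1.basis 1) = -lawG1.basis 0 := by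
    rw [LieAlgebra.ad_apply, h7]
    refine funext fun k => (hb 1 k).trans ?_
    rw [(by decide +kernel : ∀ k : Fin 8, structConst 8 tableG1 7 1 k = -if k = 0 then 1 else 0),
      LieLaw.basis_apply]
    change _ = -((Pi.single 0 1 : Fin 8 → ℝ) k)
    rw [Pi.single_apply]
    split_ifs <;> simp
  -- `ad X₈` sends `s X₁ + X₂` to `s X₂ - X₁`, which is `s` times the vector because `s² = -1`.
  refine Module.End.hasEigenvalue_of_hasEigenvector
    (x := s ⊗ₜ[ℝ] lawG1.basis 0 + 1 ⊗ₜ[ℝ] lawG1.basis 1) ⟨Module.End.mem_eigenspace_iff.2 ?_, ?_⟩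
  · rw [map_add, LinearMap.baseChange_tmul, LinearMap.baseChange_tmul, h0, h1, smul_add,
      TensorProduct.smul_tmul', TensorProduct.smul_tmul', smul_eq_mul, smul_eq_mul, hs, mul_one,
      TensorProduct.tmul_neg, TensorProduct.neg_tmul, add_comm]
  · intro hv
    have := congrArg (fun v => (lawG1.basis.baseChange ℂ).repr v 1) hv
    simp at this

/-- The characteristic polynomial commutes with base change, so if it split over `ℝ` its complex
root `i` would be real. -/
theorem not_isCompletelySolvable_lawG1 : ¬ IsCompletelySolvable ℝ lawG1.Alg := by
  rintro ⟨-, h⟩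
  have hI := hasEigenvalue_ad_lawG1 Complex.I_mul_I
  have hroot := (Module.End.hasEigenvalue_iff_isRoot_charpoly _ _).1 hI
  rw [LinearMap.charpoly_baseChange] at hroot
  obtain ⟨r, hr⟩ := (h (lawG1.basisVec 7)).mem_range_of_isRoot
    (LinearMap.charpoly_monic _).ne_zero hroot
  exact zero_ne_one (congrArg Complex.im hr)

end MainResults

theorem mainTheorem1 :
    -- both algebras are solvable, `8`-dimensional, rigid over `ℝ`, complete, with `H² = 0`
    (LieAlgebra.IsSolvable lawG1.Alg ∧ Module.finrank ℝ lawG1.Alg = 8 ∧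
      lawG1.IsRigid ∧ IsCompleteLie ℝ lawG1.Alg ∧ Subsingleton (H2Adjoint ℝ lawG1.Alg)) ∧
    (LieAlgebra.IsSolvable lawG2.Alg ∧ Module.finrank ℝ lawG2.Alg = 8 ∧
      lawG2.IsRigid ∧ IsCompleteLie ℝ lawG2.Alg ∧ Subsingleton (H2Adjoint ℝ lawG2.Alg)) ∧
    -- their nilradicals
    (∃ I : LieIdeal ℝ lawG1.Alg, IsNilradical I ∧ Nonempty (I ≃ₗ⁅ℝ⁆ lawN66.Alg)) ∧
    (∃ I : LieIdeal ℝ lawG2.Alg, IsNilradical I ∧ Nonempty (I ≃ₗ⁅ℝ⁆ lawN67.Alg)) ∧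
    -- both are real forms of the complex rigid algebra `r₈²²`
    (lawR822.IsRigid ∧ Subsingleton (H2Adjoint ℂ lawR822.Alg) ∧
      IsRealForm lawG1.Alg lawR822.Alg ∧ IsRealForm lawG2.Alg lawR822.Alg) ∧
    -- `ad X₈` has the eigenvalues `±i` (the index `7` is the last one), so `ĝ₁` is not
    -- completely solvable
    (Module.End.HasEigenvalue
        ((LieAlgebra.ad ℝ lawG1.Alg (lawG1.basisVec 7)).baseChange ℂ) Complex.I ∧
      Module.End.HasEigenvalue
        ((LieAlgebra.ad ℝ lawG1.Alg (lawG1.basisVec 7)).baseChange ℂ) (-Complex.I) ∧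
      ¬ IsCompletelySolvable ℝ lawG1.Alg) ∧
    -- a rigid solvable real Lie algebra need not be completely solvable
    (∃ (n : ℕ) (μ : LieLaw ℝ n), μ.IsRigid ∧ LieAlgebra.IsSolvable μ.Alg ∧
      ¬ IsCompletelySolvable ℝ μ.Alg) := by
  have c1 : CocyclesAreCoboundaries lawG1.1 := cocyclesAreCoboundaries_G1 ℝ
  have c2 : CocyclesAreCoboundaries lawG2.1 := cocyclesAreCoboundaries_G2 ℝ
  have c3 : CocyclesAreCoboundaries lawR822.1 := cocyclesAreCoboundaries_G2 ℂ
  exact ⟨⟨isSolvable_lawG1, lawG1.finrank_alg, lawG1.isRigid_of_cocyclesAreCoboundaries c1,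
      lawG1.isCompleteLie (derivationsAreInner_G1 ℝ) (eq_zero_of_innerConst_G1 ℝ),
      lawG1.subsingleton_h2Adjoint c1⟩,
    ⟨isSolvable_lawG2, lawG2.finrank_alg, lawG2.isRigid_of_cocyclesAreCoboundaries c2,
      lawG2.isCompleteLie (derivationsAreInner_G2 ℝ) (eq_zero_of_innerConst_G2 ℝ),
      lawG2.subsingleton_h2Adjoint c2⟩,
    ⟨nilIdealG1, isNilradical_nilIdealG1, nonempty_nilIdealG1_equiv⟩,
    ⟨nilIdealG2, isNilradical_nilIdealG2, nonempty_nilIdealG2_equiv⟩,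
    ⟨lawR822.isRigid_of_cocyclesAreCoboundaries c3, lawR822.subsingleton_h2Adjoint c3,
      isRealForm_lawG1, isRealForm_lawOfTable tableG2 isLieLaw_G2⟩,
    ⟨hasEigenvalue_ad_lawG1 Complex.I_mul_I, hasEigenvalue_ad_lawG1 (by simp),
      not_isCompletelySolvable_lawG1⟩,
    ⟨8, lawG1, lawG1.isRigid_of_cocyclesAreCoboundaries c1, isSolvable_lawG1,
      not_isCompletelySolvable_lawG1⟩⟩
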